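/- Let $P$ and $Q$ be probability distributions on finite sets $\mathcal X$ and $\mathcal Y$; let $P^n$, $Q^L$ be their i.i.d. powers, let $H$ be the Shannon entropy in bits, and assume $H(Q)>0$. Let $F(Q,Q')=\sum_y\sqrt{Q(y)Q'(y)}$ be the fidelity, let $W(P)$ be the image of $P$ under a map $W$, let $B_N=\{0,1\}^N$, and write $P\prec P'$ if for every $l$ the sum of the $l$ largest values of $P$ is at most that of $P'$. For distributions $R$ on $\mathcal X'$ and $R'$ on $\mathcal Y'$ (finite sets) define $$F^{\mathcal D}(R\to R'|N)=\sup\{F((W'\circ W)(R),R') : W:\mathcal X'\to B_N,\ W':B_N\to\mathcal Y'\},$$ $$F^{\mathcal M}(R\to R'|N)=\sup\{F(R'',R') : R\prec P'\prec R'',\ P' \text{ a distribution on } B_N,\ R''\text{ a distribution on }\mathcal Y'\}.$$ For $i\in\{\mathcal D,\mathcal M\}$, let $L^{i}_n(P,Q|\nu,N)$ be the maximal number $L$ such that some conversion of type $i$ from $P^n$ to $Q^L$ via a storage of $N$ bits, as above, has fidelity at least $\nu$. Non-integer numbers of bits or copies are rounded down, and negative ones are replaced by $0$. For real $s_1,t_1,s_2,t_2$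 put $$F^i_{P,Q,s_1,t_1,s_2}(t_2)=\liminf_{n\to\infty}F^i\big(P^n\to Q^{t_1n+t_2\sqrt n}\,\big|\,s_1n+s_2\sqrt n\big).$$ Theorem. Let $s_1>0$, $s_2\in\mathbb R$, $\nu\in(0,1)$ and $t_1=\min\{H(P),s_1\}/H(Q)$. Then for $i=\mathcal D$ and $i=\mathcal M$ the maxima $L^{i}_n(P,Q|\nu,s_1n+s_2\sqrt n)$ exist, and there is a real number $\tau$, the same for both, such that $\tau=(F^{i}_{P,Q,s_1,t_1,s_2})^{-1}(\nu)$ in the following sense: $F^i_{P,Q,s_1,t_1,s_2}(t)>\nu$ for all $t<\tau$ and $F^i_{P,Q,s_1,t_1,s_2}(t)<\nu$ for all $t>\tau$ (so $\nu$ is attained at most at $\tau$); moreover $F^i_{P,Q,s_1,t_1,s_2}(\tau)=\nu$ if $H(P)>0$ and $Q$ is not uniform on its support. As $n\to\infty$, $$L^{\mathcal D}_n(P,Q|\nu,s_1n+s_2\sqrt n)=L^{\mathcal M}_n(P,Q|\nu,s_1n+s_2\sqrt n)+o(\sqrt n),$$ $$L^{i}_n(P,Q|\nu,s_1n+s_2\sqrt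 n)=\frac{\min\{H(P),s_1\}}{H(Q)}\,n+\tau\sqrt n+o(\sqrt n)\qquad(i=\mathcal D,\mathcal M).$$ -/

import Mathlib

open Filter Topology Asymptotics

namespace RNC

noncomputable section

/-- Shannon entropy in bits of a distribution on a finite set (`0 log 0 = 0`). -/
def shannonEntropy {X : Type*} [Fintype X] (P : X → ℝ) : ℝ :=
  -∑ x, P x * Real.logb 2 (P x)

/-- The `n`-fold i.i.d. distribution `P^n` on `X^n`. -/
def iid {X : Type*} (P : X → ℝ) (n : ℕ) : (Fin n → X) → ℝ :=
  fun x => ∏ i, P (x i)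

open scoped Classical in
/-- The image distribution `W(P)` of `P` under a map `W`. -/
def push {X Y : Type*} [Fintype X] (W : X → Y) (P : X → ℝ) : Y → ℝ :=
  fun y => ∑ x with W x = y, P x

/-- Fidelity (Bhattacharyya coefficient) of two distributions on the same finite set. -/
def fidelity {Y : Type*} [Fintype Y] (Q Q' : Y → ℝ) : ℝ :=
  ∑ y, √(Q y) * √(Q' y)

/-- The space of `N`-bit strings; it has `2 ^ N` elements. -/
abbrev Bits (N : ℕ) : Type := Fin N → Bool

/-- The values of `P`, listed with multiplicity in decreasing order. -/
def sortedDesc {X : Type*} [Fintype X] (P : X → ℝ) : List ℝ :=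
  (Finset.univ.val.map P).sort (· ≥ ·)

/-- `P ≺ Q`: for every `l`, the sum of the `l` largest values of `P` is at most
the sum of the `l` largest values of `Q`. The two finite sets may differ. -/
def Majorized {X Y : Type*} [Fintype X] [Fintype Y] (P : X → ℝ) (Q : Y → ℝ) : Prop :=
  ∀ l : ℕ, ((sortedDesc P).take l).sum ≤ ((sortedDesc Q).take l).sum

/-- The fidelities with `Q` of the distributions obtained from `P` by two deterministic maps,
the first into, and the second out of, a storage of `N` bits. -/
def fidelitiesD {X Y : Type*} [Fintype X] [Fintype Y] (P : X → ℝ) (Q : Y → ℝ) (N : ℕ) : Set ℝ :=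
  {r | ∃ (W : X → Bits N) (W' : Bits N → Y), r = fidelity (push (W' ∘ W) P) Q}

/-- The fidelities with `Q` of the distributions `P''` with `P ≺ P' ≺ P''` for some distribution
`P'` on a storage of `N` bits. -/
def fidelitiesM {X Y : Type*} [Fintype X] [Fintype Y] (P : X → ℝ) (Q : Y → ℝ) (N : ℕ) : Set ℝ :=
  {r | ∃ P' ∈ stdSimplex ℝ (Bits N), ∃ P'' ∈ stdSimplex ℝ Y,
    Majorized P P' ∧ Majorized P' P'' ∧ r = fidelity P'' Q}

/-- Maximal fidelity of deterministic conversion via a storage of `N` bits. -/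
def maxFidelityD {X Y : Type*} [Fintype X] [Fintype Y] (P : X → ℝ) (Q : Y → ℝ) (N : ℕ) : ℝ :=
  sSup (fidelitiesD P Q N)

/-- Maximal fidelity of majorization conversion via a storage of `N` bits. -/
def maxFidelityM {X Y : Type*} [Fintype X] [Fintype Y] (P : X → ℝ) (Q : Y → ℝ) (N : ℕ) : ℝ :=
  sSup (fidelitiesM P Q N)

/-- The numbers `L` of copies of `Q` that can be produced from `P` with fidelity at least `ν`
by deterministic conversion via a storage of `N` bits. -/
def copiesD {X Y : Type*} [Fintype X] [Fintype Y] (P : X → ℝ) (Q : Y → ℝ) (ν : ℝ) (N : ℕ) :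
    Set ℕ :=
  {L | ∃ r ∈ fidelitiesD P (iid Q L) N, ν ≤ r}

/-- The numbers `L` of copies of `Q` that can be produced from `P` with fidelity at least `ν`
by majorization conversion via a storage of `N` bits. -/
def copiesM {X Y : Type*} [Fintype X] [Fintype Y] (P : X → ℝ) (Q : Y → ℝ) (ν : ℝ) (N : ℕ) :
    Set ℕ :=
  {L | ∃ r ∈ fidelitiesM P (iid Q L) N, ν ≤ r}

/-- Integer part of `a n + b √n` (and `0` if this is negative): used both for the number of bits
of the storage and for the number of copies of the target. -/
def size (a b : ℝ) (n : ℕ) : ℕ := ⌊a * n + b * √(n : ℝ)⌋₊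

/-- Second-order optimal accuracy of deterministic conversion: the lower limit of the maximal
fidelity from `P^n` to `t₁ n + t₂ √n` copies of `Q` via a storage of `s₁ n + s₂ √n` bits. -/
def accuracyD {X Y : Type*} [Fintype X] [Fintype Y] (P : X → ℝ) (Q : Y → ℝ)
    (s₁ t₁ s₂ t₂ : ℝ) : ℝ :=
  liminf (fun n : ℕ => maxFidelityD (iid P n) (iid Q (size t₁ t₂ n)) (size s₁ s₂ n)) atTop

/-- Second-order optimal accuracy of majorization conversion. -/
def accuracyM {X Y : Type*} [Fintype X] [Fintype Y] (P : X → ℝ) (Q : Y → ℝ)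
    (s₁ t₁ s₂ t₂ : ℝ) : ℝ :=
  liminf (fun n : ℕ => maxFidelityM (iid P n) (iid Q (size t₁ t₂ n)) (size s₁ s₂ n)) atTop

/-- `τ` is the point at which the decreasing function `f` passes from values above `ν` to values
below `ν`, i.e. `τ = f⁻¹(ν)`. If `f` takes the value `ν`, it does so at `τ` only;
if `f` jumps over `ν`, then `τ` is the point of the jump. -/
def IsInverseAt (f : ℝ → ℝ) (ν τ : ℝ) : Prop :=
  (∀ t, t < τ → ν < f t) ∧ (∀ t, τ < t → f t < ν)

/-- `Q` is uniform on its support. -/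
def UniformOnSupport {Y : Type*} (Q : Y → ℝ) : Prop :=
  ∀ y y', 0 < Q y → 0 < Q y' → Q y = Q y'

end

end RNC

namespace RNC

/-! Majorization is a statement about sums of largest values, and these have limits when `2 ^ (h * n
+ x * √n)` values are summed, `h = min (H(P)) s₁`. By the central limit theorem for `-logb 2`, the
`P^n`-mass of the points of probability at least `2 ^ (-(h * n + x * √n))` tends to a normal
distribution function of `x` if `h = H(P)`, and to `0` if `h < H(P)`. If `h = s₁`, the storage adds
a unit step at `s₂`, since all its mass sits on `2 ^ N` points. The maximum of the two is the
limiting profile `S`, and whatever can be produced from the source has, in the limit, cumulative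
values `A` that dominate `S`. For `t₁ * n + t * √n` copies of `Q` the sums at `x = H(Q) * t + c`
tend to `T c`, a normal distribution function of `c / √t₁`.

Converse: rearrangement and the Cauchy–Schwarz inequality on bins bound the fidelity by a sum of
terms `√(ΔA * ΔT)`, and compactness yields a limiting `A` (`converse_maxFidelityM`). Achievability:
lay the points of the source out in `[0,1]` in decreasing order of probability and cut the interval
into pieces, proportional to `Q` within each bin; this is a deterministic map that realizes a given
`A` dominating `S` (`le_maxFidelityD_of_profile_le`, `achievable_maxFidelityD`). The two bounds
agree up to a small shift of the argument, and such a shift amounts to a small change of `t`.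

Hence no formula for the limiting fidelity is needed. The main lemma
`exists_eventually_le_of_frequently_le` says that a majorization accuracy close to `ν` infinitely
often at `t` forces a deterministic accuracy eventually bounded above `ν` at every `t' < t`;
strictness comes from concavity of the bin sum. So both types of conversion pass `ν` at the same
point, the supremum `τ` of the `t` where the deterministic accuracy eventually exceeds `ν` by a
margin. If `Q` is not uniform on its support, `T` has a density that changes little under shifts, so
the accuracy does not jump at `τ` (`exists_forall_eventually_le`). Discarding copies never lowers
the fidelity of majorization conversion, which turns the threshold into the expansions
(`exists_expansion`). A source without entropy has `t₁ = 0` and is treated directly. -/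

/-- The sum of the `m` largest values of `P`. -/
noncomputable def topSum {X : Type*} [Fintype X] (P : X → ℝ) (m : ℕ) : ℝ :=
  ((sortedDesc P).take m).sum

/-- The `i`-th largest value of `P`, and `0` beyond the number of points. -/
noncomputable def decr {X : Type*} [Fintype X] (P : X → ℝ) (i : ℕ) : ℝ :=
  (sortedDesc P).getD i 0

/-- The mass of the points of probability at least `2 ^ (-r)`. -/
noncomputable def levelMass {X : Type*} [Fintype X] (P : X → ℝ) (r : ℝ) : ℝ :=
  ∑ x with (2 : ℝ) ^ (-r) ≤ P x, P x

/-- Lower bound on the mass of the `2 ^ r` largest values of any distribution on `N` bits that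
majorizes `P`. -/
noncomputable def profile {X : Type*} [Fintype X] (P : X → ℝ) (N : ℕ) (r : ℝ) : ℝ :=
  max (levelMass P r) (if (N : ℝ) ≤ r then 1 else 0)

/-! ### Sorted values, rearrangement and binned fidelity bounds. -/

section Sorted

variable {X Y : Type*} [Fintype X] [Fintype Y]

theorem exists_equiv_antitone (P : X → ℝ) :
    ∃ e : Fin (Fintype.card X) ≃ X, Antitone (P ∘ e) := by
  let e₀ := (Fintype.equivFin X).symm
  refine ⟨(Tuple.sort (fun i => -P (e₀ i))).trans e₀, fun i j hij => ?_⟩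
  have := Tuple.monotone_sort (fun i => -P (e₀ i)) hij
  simpa using this

theorem sortedDesc_eq_ofFn {P : X → ℝ} {e : Fin (Fintype.card X) ≃ X} (he : Antitone (P ∘ e)) :
    sortedDesc P = List.ofFn (P ∘ e) := by
  refine List.Perm.eq_of_pairwise (le := (· ≥ ·)) (fun a b _ _ h₁ h₂ => le_antisymm h₂ h₁)
    (Multiset.pairwise_sort _ _) (List.pairwise_ofFn.2 fun i j hij => he hij.le) ?_
  rw [← Multiset.coe_eq_coe, sortedDesc, Multiset.sort_eq]
  have h1 : (Finset.univ.val.map P) =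
      ((Finset.univ.map e.toEmbedding).val.map P) := by
    simp
  rw [h1, Finset.map_val, Multiset.map_map]
  simp [List.ofFn_eq_map, Fin.univ_def]

theorem decr_eq {P : X → ℝ} {e : Fin (Fintype.card X) ≃ X} (he : Antitone (P ∘ e))
    (i : Fin (Fintype.card X)) : decr P i = P (e i) := by
  simp [decr, sortedDesc_eq_ofFn he]

theorem length_sortedDesc (P : X → ℝ) : (sortedDesc P).length = Fintype.card X := by
  simp [sortedDesc]

theorem decr_of_card_le (P : X → ℝ) {i : ℕ} (hi : Fintype.card X ≤ i) : decr P i = 0 := by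
  rw [decr, List.getD_eq_default]
  rwa [length_sortedDesc]

theorem topSum_eq_sum_decr (P : X → ℝ) (m : ℕ) : topSum P m = ∑ i ∈ Finset.range m, decr P i := by
  rw [topSum]
  simp only [decr]
  generalize sortedDesc P = l
  induction m generalizing l with
  | zero => simp
  | succ m ih =>
    cases l with
    | nil => simp
    | cons a l => simp [Finset.sum_range_succ', ih, add_comm]

theorem decr_nonneg {P : X → ℝ} (hP : ∀ x, 0 ≤ P x) (i : ℕ) : 0 ≤ decr P i := by
  obtain ⟨e, he⟩ := exists_equiv_antitone P
  by_cases hi : i < Fintype.card X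
  · rw [decr_eq he ⟨i, hi⟩]; exact hP _
  · rw [decr_of_card_le P (not_lt.1 hi)]

theorem decr_antitone {P : X → ℝ} (hP : ∀ x, 0 ≤ P x) : Antitone (decr P) := by
  obtain ⟨e, he⟩ := exists_equiv_antitone P
  intro i j hij
  by_cases hj : j < Fintype.card X
  · rw [decr_eq he ⟨j, hj⟩, decr_eq he ⟨i, hij.trans_lt hj⟩]
    exact he hij
  · rw [decr_of_card_le P (not_lt.1 hj)]
    exact decr_nonneg hP i

theorem sum_decr_card (P : X → ℝ) (F : ℝ → ℝ) :
    ∑ i ∈ Finset.range (Fintype.card X), F (decr P i) = ∑ x, F (P x) := by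
  obtain ⟨e, he⟩ := exists_equiv_antitone P
  rw [Finset.sum_range, ← e.sum_comp]
  exact Finset.sum_congr rfl fun i _ => by rw [decr_eq he]

theorem topSum_mono {P : X → ℝ} (hP : ∀ x, 0 ≤ P x) : Monotone (topSum P) := by
  intro m m' h
  rw [topSum_eq_sum_decr, topSum_eq_sum_decr]
  exact Finset.sum_le_sum_of_subset_of_nonneg (Finset.range_mono h) fun i _ _ => decr_nonneg hP i

theorem topSum_of_card_le {P : X → ℝ} {m : ℕ} (h : Fintype.card X ≤ m) :
    topSum P m = ∑ x, P x := by
  have h1 := sum_decr_card P id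
  simp only [id] at h1
  rw [topSum_eq_sum_decr, ← h1]
  refine (Finset.sum_subset (Finset.range_mono h) fun i _ hi => ?_).symm
  exact decr_of_card_le P (by simpa using hi)

theorem topSum_le_sum {P : X → ℝ} (hP : ∀ x, 0 ≤ P x) (m : ℕ) : topSum P m ≤ ∑ x, P x := by
  rw [← topSum_of_card_le (P := P) (le_max_right m (Fintype.card X))]
  exact topSum_mono hP (le_max_left _ _)

theorem topSum_nonneg {P : X → ℝ} (hP : ∀ x, 0 ≤ P x) (m : ℕ) : 0 ≤ topSum P m := by
  rw [topSum_eq_sum_decr]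
  exact Finset.sum_nonneg fun i _ => decr_nonneg hP i

/-- The `k`-th smallest element of `t` is at least `k`, so sliding `t` down to an initial segment
can only increase antitone terms. -/
theorem sum_le_sum_range_of_antitone {p : ℕ → ℝ} (hp : Antitone p) (t : Finset ℕ) :
    ∑ i ∈ t, p i ≤ ∑ i ∈ Finset.range t.card, p i := by
  rw [Finset.sum_range, ← Finset.sum_coe_sort t, ← (t.orderIsoOfFin rfl).toEquiv.sum_comp]
  refine Finset.sum_le_sum fun i _ => hp ?_
  have : StrictMono fun i : Fin t.card => ((t.orderIsoOfFin rfl i : t) : ℕ) :=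
    fun a b hab => (t.orderIsoOfFin rfl).strictMono hab
  have key : ∀ k (hk : k < t.card), k ≤ ((t.orderIsoOfFin rfl ⟨k, hk⟩ : t) : ℕ) := by
    intro k
    induction k with
    | zero => intro hk; exact Nat.zero_le _
    | succ k ih =>
      intro hk
      exact (ih (by omega)).trans_lt (this (show (⟨k, by omega⟩ : Fin t.card) < ⟨k + 1, hk⟩ from
        Nat.lt_succ_self k))
  exact key i.1 i.2

theorem sum_le_topSum {P : X → ℝ} (hP : ∀ x, 0 ≤ P x) {s : Finset X} {m : ℕ} (h : s.card ≤ m) :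
    ∑ x ∈ s, P x ≤ topSum P m := by
  obtain ⟨e, he⟩ := exists_equiv_antitone P
  let g : X ↪ ℕ := e.symm.toEmbedding.trans Fin.valEmbedding
  have h1 : ∑ x ∈ s, P x = ∑ i ∈ s.map g, decr P i := by
    rw [Finset.sum_map]
    refine Finset.sum_congr rfl fun x _ => ?_
    have := decr_eq he (e.symm x)
    simp only [Equiv.apply_symm_apply] at this
    exact this.symm
  rw [h1]
  refine (sum_le_sum_range_of_antitone (decr_antitone hP) _).trans ?_
  rw [Finset.card_map, ← topSum_eq_sum_decr]
  exact topSum_mono hP h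

theorem exists_sum_eq_topSum (P : X → ℝ) (m : ℕ) :
    ∃ s : Finset X, s.card ≤ m ∧ ∑ x ∈ s, P x = topSum P m := by
  obtain ⟨e, he⟩ := exists_equiv_antitone P
  refine ⟨(Finset.univ.filter fun i : Fin (Fintype.card X) => i.1 < m).map e.toEmbedding, ?_, ?_⟩
  · rw [Finset.card_map]
    have : ((Finset.univ.filter fun i : Fin (Fintype.card X) => i.1 < m).map
        Fin.valEmbedding).card ≤ (Finset.range m).card := by
      apply Finset.card_le_card
      intro i
      simp only [Finset.mem_map, Finset.mem_filter, Finset.mem_univ, true_and, Finset.mem_range]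
      rintro ⟨a, ha, rfl⟩
      exact ha
    simpa using this
  · rw [Finset.sum_map, topSum, sortedDesc_eq_ofFn he, List.sum_take_ofFn]
    rfl

/-- The rearrangement inequality: the pairing of square roots is largest when both families are
sorted. -/
theorem fidelity_le_sum_decr (P Q : X → ℝ) :
    fidelity P Q ≤ ∑ i ∈ Finset.range (Fintype.card X), √(decr P i) * √(decr Q i) := by
  obtain ⟨e, he⟩ := exists_equiv_antitone P
  obtain ⟨e', he'⟩ := exists_equiv_antitone Q
  rw [Finset.sum_range, fidelity, ← e.sum_comp]
  have h := Monovary.sum_mul_comp_perm_le_sum_mul (σ := e.trans e'.symm)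
    (f := fun i => √(P (e i))) (g := fun i => √(Q (e' i))) (by
      have h1 : Antitone fun i => √(P (e i)) := fun i j hij => Real.sqrt_le_sqrt (he hij)
      have h2 : Antitone fun i => √(Q (e' i)) := fun i j hij => Real.sqrt_le_sqrt (he' hij)
      exact h1.monovary h2)
  simp only [Equiv.trans_apply, Equiv.apply_symm_apply] at h
  refine h.trans (le_of_eq (Finset.sum_congr rfl fun i _ => ?_))
  rw [decr_eq he, decr_eq he']

/-- Cauchy–Schwarz separately on each block of indices between consecutive `m j`. -/
theorem sum_sqrt_mul_sqrt_range_le {p q : ℕ → ℝ} (hp : ∀ i, 0 ≤ p i) (hq : ∀ i, 0 ≤ q i)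
    {m : ℕ → ℕ} (hm : Monotone m) (k : ℕ) :
    ∑ i ∈ Finset.range (m k), √(p i) * √(q i) ≤
      √((∑ i ∈ Finset.range (m 0), p i) * ∑ i ∈ Finset.range (m 0), q i) +
      ∑ j ∈ Finset.range k,
        √((∑ i ∈ Finset.range (m (j + 1)), p i - ∑ i ∈ Finset.range (m j), p i) *
          (∑ i ∈ Finset.range (m (j + 1)), q i - ∑ i ∈ Finset.range (m j), q i)) := by
  induction k with
  | zero =>
    simp only [Finset.range_zero, Finset.sum_empty, add_zero]
    rw [Real.sqrt_mul (Finset.sum_nonneg fun i _ => hp i)]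
    exact Real.sum_sqrt_mul_sqrt_le _ hp hq
  | succ k ih =>
    rw [Finset.sum_range_succ _ k, ← add_assoc]
    have hk : m k ≤ m (k + 1) := hm (Nat.le_succ k)
    rw [← Finset.sum_range_add_sum_Ico _ hk]
    refine add_le_add ih ?_
    rw [← Finset.sum_Ico_eq_sub _ hk, ← Finset.sum_Ico_eq_sub _ hk,
      Real.sqrt_mul (Finset.sum_nonneg fun i _ => hp i)]
    exact Real.sum_sqrt_mul_sqrt_le _ hp hq

theorem fidelity_le_of_monotone {P Q : X → ℝ} (hP : P ∈ stdSimplex ℝ X) (hQ : Q ∈ stdSimplex ℝ X)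
    {m : ℕ → ℕ} (hm : Monotone m) (k : ℕ) :
    fidelity P Q ≤ √(topSum P (m 0) * topSum Q (m 0)) +
      ∑ j ∈ Finset.range k,
        √((topSum P (m (j + 1)) - topSum P (m j)) * (topSum Q (m (j + 1)) - topSum Q (m j))) +
      √((1 - topSum P (m k)) * (1 - topSum Q (m k))) := by
  -- Beyond index `k` the boundaries are pushed past the number of points, so that block `k + 1` is
  -- the whole tail, of mass `1 - topSum _ (m k)`.
  let m' : ℕ → ℕ := fun j => if j ≤ k then m j else max (m j) (Fintype.card X)
  have hm' : Monotone m' := by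
    intro i j hij
    simp only [m']
    split_ifs with h1 h2 h2
    · exact hm hij
    · exact (hm hij).trans (le_max_left _ _)
    · omega
    · exact max_le_max (hm hij) le_rfl
  have h := sum_sqrt_mul_sqrt_range_le (decr_nonneg hP.1) (decr_nonneg hQ.1) hm' (k + 1)
  rw [Finset.sum_range_succ, ← add_assoc] at h
  simp only [← topSum_eq_sum_decr] at h
  have e1 : m' (k + 1) = max (m (k + 1)) (Fintype.card X) := by simp [m']
  have e2 : m' k = m k := by simp [m']
  have e3 : m' 0 = m 0 := by simp [m']
  rw [e1, e2, e3, topSum_of_card_le (P := P) (le_max_right _ _),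
    topSum_of_card_le (P := Q) (le_max_right _ _), hP.2, hQ.2] at h
  refine (fidelity_le_sum_decr P Q).trans (le_trans ?_ (h.trans (le_of_eq ?_)))
  · exact Finset.sum_le_sum_of_subset_of_nonneg (Finset.range_mono (le_max_right _ _))
      fun i _ _ => mul_nonneg (Real.sqrt_nonneg _) (Real.sqrt_nonneg _)
  · congr 2
    refine Finset.sum_congr rfl fun j hj => ?_
    have hj' := Finset.mem_range.1 hj
    have e4 : m' j = m j := if_pos (by omega)
    have e5 : m' (j + 1) = m (j + 1) := if_pos (by omega)
    rw [e4, e5]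

end Sorted

/-! ### Level masses, images under maps, and elementary bounds on conversions. -/

section Conversion

variable {X Y Z : Type*} [Fintype X] [Fintype Y] [Fintype Z]

theorem levelMass_nonneg {P : X → ℝ} (hP : ∀ x, 0 ≤ P x) (r : ℝ) : 0 ≤ levelMass P r :=
  Finset.sum_nonneg fun x _ => hP x

theorem levelMass_mono {P : X → ℝ} (hP : ∀ x, 0 ≤ P x) : Monotone (levelMass P) := by
  intro r r' h
  refine Finset.sum_le_sum_of_subset_of_nonneg (fun x => ?_) fun x _ _ => hP x
  simp only [Finset.mem_filter, Finset.mem_univ, true_and]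
  exact (Real.rpow_le_rpow_of_exponent_le one_le_two (neg_le_neg h)).trans

theorem levelMass_le_one {P : X → ℝ} (hP : P ∈ stdSimplex ℝ X) (r : ℝ) : levelMass P r ≤ 1 := by
  rw [← hP.2]
  exact Finset.sum_le_sum_of_subset_of_nonneg (Finset.filter_subset _ _) fun x _ _ => hP.1 x

theorem card_level_le {P : X → ℝ} (hP : P ∈ stdSimplex ℝ X) (r : ℝ) :
    ((Finset.univ.filter fun x => (2 : ℝ) ^ (-r) ≤ P x).card : ℝ) ≤ 2 ^ r := by
  have h1 : ((Finset.univ.filter fun x => (2 : ℝ) ^ (-r) ≤ P x).card : ℝ) * 2 ^ (-r) ≤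
      levelMass P r := by
    rw [← nsmul_eq_mul]
    exact Finset.card_nsmul_le_sum _ _ _ fun x hx => (Finset.mem_filter.1 hx).2
  have h2 := h1.trans (levelMass_le_one hP r)
  have h3 : (2 : ℝ) ^ (-r) = (2 ^ r)⁻¹ := Real.rpow_neg zero_le_two r
  exact (div_le_one (by positivity)).1 ((div_eq_mul_inv _ _).trans_le
    ((congrArg _ h3.symm).trans_le h2))

theorem levelMass_le_topSum {P : X → ℝ} (hP : P ∈ stdSimplex ℝ X) (r : ℝ) :
    levelMass P r ≤ topSum P ⌊(2 : ℝ) ^ r⌋₊ :=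
  sum_le_topSum hP.1 (Nat.le_floor (card_level_le hP r))

/-- Among the `2 ^ r` largest points, those of probability below `2 ^ (-(r + e))` weigh at most `2 ^
r * 2 ^ (-(r + e))` together. With `levelMass_le_topSum` this lets level masses, to which the
central limit theorem applies, replace sums of largest values. -/
theorem topSum_le_levelMass_add {P : X → ℝ} (hP : P ∈ stdSimplex ℝ X) (r e : ℝ) :
    topSum P ⌊(2 : ℝ) ^ r⌋₊ ≤ levelMass P (r + e) + 2 ^ (-e) := by
  obtain ⟨s, hs, h⟩ := exists_sum_eq_topSum P ⌊(2 : ℝ) ^ r⌋₊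
  rw [← h, ← Finset.sum_filter_add_sum_filter_not s (fun x => (2 : ℝ) ^ (-(r + e)) ≤ P x)]
  refine add_le_add ?_ ?_
  · exact Finset.sum_le_sum_of_subset_of_nonneg
      (Finset.filter_subset_filter _ (Finset.subset_univ s)) fun x _ _ => hP.1 x
  · have h1 : ∑ x ∈ s with ¬ (2 : ℝ) ^ (-(r + e)) ≤ P x, P x ≤
        (s.filter fun x => ¬ (2 : ℝ) ^ (-(r + e)) ≤ P x).card • (2 : ℝ) ^ (-(r + e)) :=
      Finset.sum_le_card_nsmul _ _ _ fun x hx => (not_le.1 (Finset.mem_filter.1 hx).2).le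
    refine h1.trans ?_
    rw [nsmul_eq_mul]
    have h2 : ((s.filter fun x => ¬ (2 : ℝ) ^ (-(r + e)) ≤ P x).card : ℝ) ≤ 2 ^ r := by
      refine le_trans ?_ (Nat.floor_le (by positivity))
      exact_mod_cast (Finset.card_filter_le _ _).trans hs
    calc _ ≤ (2 : ℝ) ^ r * 2 ^ (-(r + e)) := by gcongr
      _ = 2 ^ (-e) := by rw [← Real.rpow_add two_pos]; congr 1; ring

/-- Both constraints survive majorization: the level mass of the source bounds its top sums from
below, and `P'` has all its mass on `2 ^ N` points. -/
theorem profile_le_topSum {P : X → ℝ} {N : ℕ} {P' : Bits N → ℝ} {P'' : Y → ℝ}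
    (hP : P ∈ stdSimplex ℝ X) (hP' : P' ∈ stdSimplex ℝ (Bits N)) (hP'' : ∀ y, 0 ≤ P'' y)
    (h : Majorized P P') (h' : Majorized P' P'') (r : ℝ) :
    profile P N r ≤ topSum P'' ⌊(2 : ℝ) ^ r⌋₊ := by
  refine max_le ((levelMass_le_topSum hP r).trans ((h _).trans (h' _))) ?_
  split_ifs with hN
  · refine le_trans (le_of_eq ?_) (h' _)
    have hcard : Fintype.card (Bits N) ≤ ⌊(2 : ℝ) ^ r⌋₊ := by
      simp only [Bits, Fintype.card_fun, Fintype.card_bool, Fintype.card_fin]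
      refine Nat.le_floor ?_
      push_cast
      rw [← Real.rpow_natCast]
      exact Real.rpow_le_rpow_of_exponent_le one_le_two hN
    rw [← hP'.2]
    exact (topSum_of_card_le hcard).symm
  · exact topSum_nonneg hP'' _

/-! ### Images under maps -/

theorem push_nonneg {A B : Type*} [Fintype A] {P : A → ℝ} (hP : ∀ x, 0 ≤ P x) (W : A → B) (y : B) : 0 ≤ push W P y :=
  Finset.sum_nonneg fun x _ => hP x

theorem sum_push (P : X → ℝ) (W : X → Y) : ∑ y, push W P y = ∑ x, P x := by
  classical
  simp only [push]
  convert Finset.sum_fiberwise Finset.univ W P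

theorem push_mem_stdSimplex {P : X → ℝ} (hP : P ∈ stdSimplex ℝ X) (W : X → Y) :
    push W P ∈ stdSimplex ℝ Y :=
  ⟨push_nonneg hP.1 W, (sum_push P W).trans hP.2⟩

theorem push_push {A B C : Type*} [Fintype A] [Fintype B] (P : A → ℝ) (W : A → B) (W' : B → C) :
    push W' (push W P) = push (W' ∘ W) P := by
  classical
  funext z
  simp only [push, Function.comp]
  rw [Finset.sum_filter]
  have : ∀ x : A, (if W' (W x) = z then P x else 0) =
      ∑ y, if W' y = z then (if W x = y then P x else 0) else 0 := by
    intro x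
    rw [Finset.sum_eq_single (W x)]
    · simp
    · intro y _ hy; simp [hy.symm]
    · simp
  conv_rhs => rw [Finset.sum_filter, Finset.sum_congr rfl fun x _ => this x, Finset.sum_comm]
  refine Finset.sum_congr rfl fun y _ => ?_
  split_ifs
  · rw [Finset.sum_filter]
  · simp

/-- The image of an optimal `m`-point set has at most `m` points and carries at least its mass. -/
theorem majorized_push {P : X → ℝ} (hP : ∀ x, 0 ≤ P x) (W : X → Y) :
    Majorized P (push W P) := by
  classical
  intro m
  change topSum P m ≤ topSum (push W P) m
  obtain ⟨s, hs, h⟩ := exists_sum_eq_topSum P m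
  rw [← h]
  refine le_trans ?_ (sum_le_topSum (push_nonneg hP W) (Finset.card_image_le.trans hs) :
    ∑ y ∈ s.image W, push W P y ≤ _)
  have h1 : ∀ y ∈ s.image W, ∑ x ∈ s with W x = y, P x ≤ push W P y := by
    intro y _
    rw [push]
    refine Finset.sum_le_sum_of_subset_of_nonneg (fun x => ?_) fun x _ _ => hP x
    simp
  refine le_trans (le_of_eq ?_) (Finset.sum_le_sum h1)
  exact (Finset.sum_fiberwise_of_maps_to (fun x hx => Finset.mem_image_of_mem W hx) P).symm

theorem Majorized.trans' {P : X → ℝ} {Q : Y → ℝ} {R : Z → ℝ} (h : Majorized P Q)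
    (h' : Majorized Q R) : Majorized P R := fun m => (h m).trans (h' m)

theorem fidelitiesD_subset_fidelitiesM {P : X → ℝ} (hP : P ∈ stdSimplex ℝ X) (Q : Y → ℝ) (N : ℕ) :
    fidelitiesD P Q N ⊆ fidelitiesM P Q N := by
  rintro r ⟨W, W', rfl⟩
  refine ⟨push W P, push_mem_stdSimplex hP W, push (W' ∘ W) P, push_mem_stdSimplex hP _,
    majorized_push hP.1 W, ?_, rfl⟩
  rw [← push_push]
  exact majorized_push (push_nonneg hP.1 W) W'

theorem fidelity_nonneg (P Q : X → ℝ) : 0 ≤ fidelity P Q :=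
  Finset.sum_nonneg fun _ _ => mul_nonneg (Real.sqrt_nonneg _) (Real.sqrt_nonneg _)

theorem fidelity_le_one {P Q : X → ℝ} (hP : P ∈ stdSimplex ℝ X) (hQ : Q ∈ stdSimplex ℝ X) :
    fidelity P Q ≤ 1 := by
  refine (Real.sum_sqrt_mul_sqrt_le _ hP.1 hQ.1).trans ?_
  rw [hP.2, hQ.2]; simp

/-- Data processing: Cauchy–Schwarz on each fibre of `W`. -/
theorem fidelity_le_fidelity_push {P Q : X → ℝ} (hP : ∀ x, 0 ≤ P x) (hQ : ∀ x, 0 ≤ Q x)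
    (W : X → Y) : fidelity P Q ≤ fidelity (push W P) (push W Q) := by
  classical
  rw [fidelity, ← Finset.sum_fiberwise Finset.univ W]
  refine Finset.sum_le_sum fun y _ => ?_
  simp only [push]
  convert Real.sum_sqrt_mul_sqrt_le _ hP hQ

theorem bddAbove_fidelitiesM (P : X → ℝ) {Q : Y → ℝ} (hQ : Q ∈ stdSimplex ℝ Y) (N : ℕ) :
    BddAbove (fidelitiesM P Q N) := by
  refine ⟨1, ?_⟩
  rintro r ⟨_, _, P'', h, _, _, rfl⟩
  exact fidelity_le_one h hQ

theorem fidelitiesD_nonempty (P : X → ℝ) {Q : Y → ℝ} (hQ : Q ∈ stdSimplex ℝ Y) (N : ℕ) :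
    (fidelitiesD P Q N).Nonempty := by
  have : Nonempty Y := by
    by_contra h
    rw [not_nonempty_iff] at h
    have := hQ.2
    simp at this
  exact ⟨_, fun _ _ => false, fun _ => Classical.arbitrary Y, rfl⟩

theorem maxFidelityD_le_maxFidelityM {P : X → ℝ} (hP : P ∈ stdSimplex ℝ X) {Q : Y → ℝ}
    (hQ : Q ∈ stdSimplex ℝ Y) (N : ℕ) : maxFidelityD P Q N ≤ maxFidelityM P Q N :=
  csSup_le_csSup (bddAbove_fidelitiesM P hQ N) (fidelitiesD_nonempty P hQ N)
    (fidelitiesD_subset_fidelitiesM hP Q N)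

theorem le_maxFidelityD {P : X → ℝ} (hP : P ∈ stdSimplex ℝ X) {Q : Y → ℝ}
    (hQ : Q ∈ stdSimplex ℝ Y) {N : ℕ} {r : ℝ} (hr : r ∈ fidelitiesD P Q N) :
    r ≤ maxFidelityD P Q N :=
  le_csSup ((bddAbove_fidelitiesM P hQ N).mono (fidelitiesD_subset_fidelitiesM hP Q N)) hr

theorem maxFidelityM_le_one {P : X → ℝ} (hP : P ∈ stdSimplex ℝ X) {Q : Y → ℝ}
    (hQ : Q ∈ stdSimplex ℝ Y) (N : ℕ) : maxFidelityM P Q N ≤ 1 := by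
  refine csSup_le ((fidelitiesD_nonempty P hQ N).mono (fidelitiesD_subset_fidelitiesM hP Q N)) ?_
  rintro r ⟨_, _, P'', h, _, _, rfl⟩
  exact fidelity_le_one h hQ

theorem maxFidelityD_nonneg (P : X → ℝ) (Q : Y → ℝ) (N : ℕ) : 0 ≤ maxFidelityD P Q N := by
  refine Real.sSup_nonneg ?_
  rintro r ⟨W, W', rfl⟩
  exact fidelity_nonneg _ _

/-! ### Independent copies -/

theorem iid_mem_stdSimplex {P : X → ℝ} (hP : P ∈ stdSimplex ℝ X) (n : ℕ) :
    iid P n ∈ stdSimplex ℝ (Fin n → X) := by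
  classical
  refine ⟨fun x => Finset.prod_nonneg fun i _ => hP.1 _, ?_⟩
  have := Finset.prod_univ_sum (fun _ : Fin n => (Finset.univ : Finset X)) (fun _ x => P x)
  rw [Fintype.piFinset_univ] at this
  simp only [iid]
  rw [← this, hP.2]
  simp

theorem push_init_iid {Q : Y → ℝ} (hQ : Q ∈ stdSimplex ℝ Y) (L : ℕ) :
    push (fun y : Fin (L + 1) → Y => Fin.init (α := fun _ => Y) y) (iid Q (L + 1)) = iid Q L := by
  classical
  funext z
  have h : ∀ F : (Fin (L + 1) → Y) → ℝ, (∑ y with Fin.init (α := fun _ => Y) y = z, F y) =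
      ∑ a, F (Fin.snoc (α := fun _ => Y) z a) := fun F => by
    refine Finset.sum_bij' (fun y _ => y (Fin.last L))
      (fun a _ => Fin.snoc (α := fun _ => Y) z a) (fun _ _ => Finset.mem_univ _) (fun a _ => ?_)
      (fun y hy => ?_) (fun a _ => ?_) (fun y hy => ?_)
    · simp
    · obtain rfl := (Finset.mem_filter.1 hy).2
      exact Fin.snoc_init_self (α := fun _ => Y) y
    · exact Fin.snoc_last (α := fun _ => Y) _ _
    · obtain rfl := (Finset.mem_filter.1 hy).2
      rw [Fin.snoc_init_self (α := fun _ => Y) y]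
  refine Eq.trans ?_ ((h (iid Q (L + 1))).trans ?_)
  · simp only [push]
  · simp only [iid, Fin.prod_univ_castSucc, Fin.snoc_castSucc, Fin.snoc_last]
    rw [← Finset.mul_sum, hQ.2, mul_one]

/-- Forgetting the last copy keeps the majorization relations, as they compose with images, and does
not decrease the fidelity. -/
theorem copiesM_of_succ {P : X → ℝ} {Q : Y → ℝ} (hQ : Q ∈ stdSimplex ℝ Y)
    {ν : ℝ} {N L : ℕ} (h : L + 1 ∈ copiesM P Q ν N) : L ∈ copiesM P Q ν N := by
  obtain ⟨r, ⟨P', hP', P'', hP'', h1, h2, rfl⟩, hr⟩ := h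
  refine ⟨_, ⟨P', hP', push (fun y : Fin (L + 1) → Y => Fin.init (α := fun _ => Y) y) P'',
    push_mem_stdSimplex hP'' _, h1, h2.trans' (majorized_push hP''.1 _), rfl⟩, hr.trans ?_⟩
  rw [← push_init_iid hQ L]
  exact fidelity_le_fidelity_push hP''.1 (iid_mem_stdSimplex hQ _).1 _

theorem copiesM_of_le {P : X → ℝ} {Q : Y → ℝ} (hQ : Q ∈ stdSimplex ℝ Y)
    {ν : ℝ} {N L L' : ℕ} (hL : L ≤ L') (h : L' ∈ copiesM P Q ν N) : L ∈ copiesM P Q ν N := by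
  induction L', hL using Nat.le_induction with
  | base => exact h
  | succ k _ ih => exact ih (copiesM_of_succ hQ h)

theorem copiesD_subset_copiesM {P : X → ℝ} (hP : P ∈ stdSimplex ℝ X) (Q : Y → ℝ) (ν : ℝ) (N : ℕ) :
    copiesD P Q ν N ⊆ copiesM P Q ν N := by
  rintro L ⟨r, hr, h⟩
  exact ⟨r, fidelitiesD_subset_fidelitiesM hP _ N hr, h⟩

theorem fidelity_eq_one_of_subsingleton [Subsingleton X] {P Q : X → ℝ} (hP : P ∈ stdSimplex ℝ X)
    (hQ : Q ∈ stdSimplex ℝ X) : fidelity P Q = 1 := by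
  have hX : Nonempty X := by
    by_contra h
    rw [not_nonempty_iff] at h
    have := hQ.2
    simp at this
  obtain ⟨x⟩ := hX
  have : Unique X := ⟨⟨x⟩, fun y => Subsingleton.elim _ _⟩
  have h1 := hP.2
  have h2 := hQ.2
  rw [Fintype.sum_unique] at h1 h2
  rw [fidelity, Fintype.sum_unique, h1, h2]
  simp

theorem zero_mem_copiesD {P : X → ℝ} (hP : P ∈ stdSimplex ℝ X) {Q : Y → ℝ}
    (hQ : Q ∈ stdSimplex ℝ Y) {ν : ℝ} (hν : ν ≤ 1) (N : ℕ) : 0 ∈ copiesD P Q ν N := by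
  obtain ⟨r, hr⟩ := fidelitiesD_nonempty P (iid_mem_stdSimplex hQ 0) N
  refine ⟨r, hr, ?_⟩
  obtain ⟨W, W', rfl⟩ := hr
  rwa [fidelity_eq_one_of_subsingleton (push_mem_stdSimplex hP _) (iid_mem_stdSimplex hQ 0)]

theorem iid_le_pow {Q : Y → ℝ} (hQ : Q ∈ stdSimplex ℝ Y) {q : ℝ} (hq : ∀ y, Q y ≤ q) (L : ℕ)
    (y : Fin L → Y) : iid Q L y ≤ q ^ L := by
  have := Finset.prod_le_prod (s := Finset.univ) (fun i _ => hQ.1 (y i)) fun i _ => hq (y i)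
  simpa [iid] using this

/-- A distribution with only `m` points has small fidelity with a spread-out distribution. -/
theorem fidelity_le_of_topSum_eq_one {P Q : X → ℝ} (hP : P ∈ stdSimplex ℝ X)
    (hQ : Q ∈ stdSimplex ℝ X) {q : ℝ} (hq : ∀ x, Q x ≤ q) {m : ℕ} (hm : 1 ≤ topSum P m) :
    fidelity P Q ≤ √(m * q) := by
  have h := fidelity_le_of_monotone hP hQ (m := fun _ => m) monotone_const 0
  have h1 : topSum P m = 1 := le_antisymm ((topSum_le_sum hP.1 m).trans hP.2.le) hm
  simp only [h1, one_mul, Finset.range_zero, Finset.sum_empty, add_zero, sub_self, zero_mul,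
    Real.sqrt_zero] at h
  refine h.trans (Real.sqrt_le_sqrt ?_)
  obtain ⟨s, hs, h2⟩ := exists_sum_eq_topSum Q m
  rw [← h2]
  have hq0 : 0 ≤ q := by
    by_contra hneg
    have h3 : ∀ x, Q x ≤ 0 := fun x => (hq x).trans (not_le.1 hneg).le
    have := hQ.2
    have h4 := Finset.sum_nonpos (s := Finset.univ) fun x _ => h3 x
    linarith
  refine (Finset.sum_le_card_nsmul s Q q fun x _ => hq x).trans ?_
  rw [nsmul_eq_mul]
  gcongr

/-- The output is carried by `2 ^ N` points, each of probability at most `q ^ L` under the target.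
For `q < 1` this bounds the number of copies. -/
theorem le_sqrt_of_mem_fidelitiesM {P : X → ℝ} {Q : Y → ℝ} (hQ : Q ∈ stdSimplex ℝ Y) {q : ℝ}
    (hq : ∀ y, Q y ≤ q) {N L : ℕ} {r : ℝ} (hr : r ∈ fidelitiesM P (iid Q L) N) :
    r ≤ √(2 ^ N * q ^ L) := by
  obtain ⟨P', hP', P'', hP'', _, h2, rfl⟩ := hr
  have h3 : (1 : ℝ) ≤ topSum P'' (2 ^ N) := by
    refine le_trans (le_of_eq ?_) (h2 _)
    rw [← hP'.2]
    exact (topSum_of_card_le (by simp [Bits])).symm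
  have := fidelity_le_of_topSum_eq_one hP'' (iid_mem_stdSimplex hQ L) (iid_le_pow hQ hq L) h3
  exact_mod_cast this

end Conversion

/-! ### Deterministic maps onto prescribed weights; one-shot achievability and converse. -/

section Quantile

variable {X Y : Type*} [Fintype X] [Fintype Y]

/-- The indices whose preceding sum lies in `[l, l + w)` form an interval from `i₀` to `i₁`, of mass
`C i₁ - C i₀`. Only an overshoot of `C i₀` above `l` can lose mass, and it is at most the last term
added. If that term exceeds `η`, so do all earlier ones, and then `C i₀ ≤ l` by hypothesis. -/
theorem sub_le_sum_quantile {p : ℕ → ℝ} (hp : Antitone p) (hp0 : ∀ i, 0 ≤ p i) {k : ℕ}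
    {l w η : ℝ} (hl : 0 ≤ l) (hw : 0 ≤ w) (hη : 0 ≤ η)
    (hk : l + w ≤ ∑ i ∈ Finset.range k, p i)
    (h : ∑ i ∈ Finset.range k with η < p i, p i ≤ l) :
    w - η ≤ ∑ i ∈ Finset.range k with
      l ≤ ∑ j ∈ Finset.range i, p j ∧ ∑ j ∈ Finset.range i, p j < l + w, p i := by
  classical
  set C : ℕ → ℝ := fun i => ∑ j ∈ Finset.range i, p j with hC
  have hex : ∃ i, l ≤ C i := ⟨k, by linarith⟩
  have hex' : ∃ i, l + w ≤ C i := ⟨k, hk⟩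
  let i₀ := Nat.find hex
  let i₁ := Nat.find hex'
  have h0 : l ≤ C i₀ := Nat.find_spec hex
  have h1 : l + w ≤ C i₁ := Nat.find_spec hex'
  have h1k : i₁ ≤ k := Nat.find_min' hex' hk
  have h01 : i₀ ≤ i₁ := Nat.find_min' hex (by linarith)
  have hCmono : Monotone C := fun a b hab =>
    Finset.sum_le_sum_of_subset_of_nonneg (Finset.range_mono hab) fun i _ _ => hp0 i
  have hsub : Finset.Ico i₀ i₁ ⊆ (Finset.range k).filter fun i => l ≤ C i ∧ C i < l + w := by
    intro i hi
    rw [Finset.mem_Ico] at hi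
    rw [Finset.mem_filter, Finset.mem_range]
    refine ⟨hi.2.trans_le h1k, h0.trans (hCmono hi.1), ?_⟩
    exact not_le.1 (Nat.find_min hex' hi.2)
  refine le_trans ?_ (Finset.sum_le_sum_of_subset_of_nonneg hsub fun i _ _ => hp0 i)
  rw [Finset.sum_Ico_eq_sub _ h01]
  change w - η ≤ C i₁ - C i₀
  have h2 : C i₀ ≤ l + η := by
    rcases Nat.eq_zero_or_pos i₀ with hz | hz
    · rw [hz, hC]; simp; linarith
    · obtain ⟨i, hi⟩ := Nat.exists_eq_succ_of_ne_zero hz.ne'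
      have h3 : C i < l := not_le.1 (Nat.find_min hex (by omega))
      have h4 : C i₀ = C i + p i := by rw [hi]; exact Finset.sum_range_succ _ _
      by_cases h5 : p i ≤ η
      · linarith
      · refine (le_trans ?_ h).trans (by linarith)
        refine Finset.sum_le_sum_of_subset_of_nonneg (fun j hj => ?_) fun i _ _ => hp0 i
        rw [Finset.mem_range] at hj
        rw [Finset.mem_filter, Finset.mem_range]
        exact ⟨by omega, (not_le.1 h5).trans_le (hp (by omega))⟩
  linarith

/-- A distribution can be mapped onto prescribed weights, laid out as disjoint intervals in `[0,1]`,
as far as its points to the right of an interval are small compared with the weight. -/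
theorem exists_push_ge {A B : Type*} [Fintype A] {P : A → ℝ} (hP : P ∈ stdSimplex ℝ A)
    {s : Finset B} (hs : s.Nonempty) {l w η : B → ℝ} (hl : ∀ y ∈ s, 0 ≤ l y) (hw : ∀ y ∈ s, 0 ≤ w y) (hη : ∀ y ∈ s, 0 ≤ η y)
    (hlw : ∀ y ∈ s, l y + w y ≤ 1)
    (hdisj : ∀ y ∈ s, ∀ y' ∈ s, y ≠ y' → l y + w y ≤ l y' ∨ l y' + w y' ≤ l y)
    (h : ∀ y ∈ s, ∑ x with η y < P x, P x ≤ l y) :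
    ∃ f : A → B, (∀ x, f x ∈ s) ∧ ∀ y ∈ s, w y - η y ≤ push f P y := by
  classical
  obtain ⟨e, he⟩ := exists_equiv_antitone P
  obtain ⟨y₀, hy₀⟩ := hs
  let C : ℕ → ℝ := fun i => ∑ j ∈ Finset.range i, decr P j
  let R : A → B → Prop := fun x y => y ∈ s ∧ l y ≤ C (e.symm x) ∧ C (e.symm x) < l y + w y
  -- A point goes to the interval containing the mass that precedes it. Points in no interval go to
  -- `y₀`, which is harmless since only lower bounds on the image are claimed.
  let f : A → B := fun x => if hx : ∃ y, R x y then hx.choose else y₀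
  have hfR : ∀ x y, R x y → f x = y := by
    intro x y hxy
    have hx : ∃ y, R x y := ⟨y, hxy⟩
    have h1 : R x (f x) := by
      simp only [f, dif_pos hx]
      exact hx.choose_spec
    by_contra hne
    obtain ⟨a1, a2, a3⟩ := h1
    obtain ⟨b1, b2, b3⟩ := hxy
    rcases hdisj _ a1 _ b1 hne with h2 | h2 <;> linarith
  refine ⟨f, fun x => ?_, fun y hy => ?_⟩
  · by_cases hx : ∃ y, R x y
    · obtain ⟨y, hxy⟩ := hx
      rw [hfR x y hxy]; exact hxy.1
    · simp only [f, dif_neg hx]; exact hy₀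
  · have hsum := sum_decr_card P id
    simp only [id, hP.2] at hsum
    have hmass : ∑ i ∈ Finset.range (Fintype.card A) with η y < decr P i, decr P i ≤ l y := by
      refine le_trans (le_of_eq ?_) (h y hy)
      rw [Finset.sum_filter, Finset.sum_filter]
      exact sum_decr_card P fun t => if η y < t then t else 0
    refine (sub_le_sum_quantile (decr_antitone hP.1) (decr_nonneg hP.1) (hl y hy) (hw y hy)
      (hη y hy) (by rw [hsum]; exact hlw y hy) hmass).trans ?_
    rw [push, Finset.sum_filter, Finset.sum_filter, Finset.sum_range, ← e.sum_comp]
    refine Finset.sum_le_sum fun i _ => ?_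
    rw [decr_eq he]
    by_cases hc : l y ≤ C i ∧ C i < l y + w y
    · have hf : f (e i) = y := hfR _ _ ⟨hy, by simpa using hc⟩
      rw [if_pos hc, if_pos hf]
    · rw [if_neg hc]
      split_ifs
      · exact hP.1 _
      · exact le_rfl

/-- The few points of `s` can be encoded injectively as bit strings, and decoding is a left inverse.
-/
theorem fidelity_push_mem_fidelitiesD (P : X → ℝ) (Q : Y → ℝ) {N : ℕ} {f : X → Y} {s : Finset Y}
    (hs : s.Nonempty) (hcard : s.card ≤ 2 ^ N) (hf : ∀ x, f x ∈ s) :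
    fidelity (push f P) Q ∈ fidelitiesD P Q N := by
  have hle : Fintype.card s ≤ Fintype.card (Bits N) := by simpa [Bits] using hcard
  obtain ⟨g⟩ := Function.Embedding.nonempty_of_card_le hle
  have : Nonempty s := hs.to_subtype
  refine ⟨fun x => g ⟨f x, hf x⟩, fun b => (Function.invFun g b : s), ?_⟩
  congr 2
  funext x
  simp [Function.leftInverse_invFun g.injective _]

theorem sum_bin_eq (Q : Y → ℝ) {r r' : ℝ} (h : r ≤ r') :
    ∑ y with (2 : ℝ) ^ (-r') ≤ Q y ∧ Q y < 2 ^ (-r), Q y = levelMass Q r' - levelMass Q r := by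
  classical
  rw [levelMass, levelMass, eq_sub_iff_add_eq, ← Finset.sum_union]
  · refine Finset.sum_congr ?_ fun _ _ => rfl
    ext y
    have h1 : (2 : ℝ) ^ (-r') ≤ 2 ^ (-r) :=
      Real.rpow_le_rpow_of_exponent_le one_le_two (neg_le_neg h)
    simp only [Finset.mem_union, Finset.mem_filter, Finset.mem_univ, true_and]
    constructor
    · rintro (h2 | h2)
      · exact h2.1
      · exact h1.trans h2
    · intro h2
      by_cases h3 : (2 : ℝ) ^ (-r) ≤ Q y
      · exact Or.inr h3
      · exact Or.inl ⟨h2, not_le.1 h3⟩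
  · rw [Finset.disjoint_filter]
    intro y _ h2 h3
    exact absurd h2.2 (not_lt.2 h3)

/-- Achievability by deterministic conversion: masses `A (j + 1) - A j` can be placed on the points
of probability between `2 ^ (-ρ (j + 1))` and `2 ^ (-ρ j)`, in proportion to `Q`, if the values
of `A` dominate the profile of the source. -/
theorem le_maxFidelityD_of_profile_le {P : X → ℝ} (hP : P ∈ stdSimplex ℝ X) {Q : Y → ℝ}
    (hQ : Q ∈ stdSimplex ℝ Y) {N : ℕ} {ρ A : ℕ → ℝ} (hρ : Monotone ρ) (hA : Monotone A)
    (hA0 : 0 ≤ A 0) (hA1 : ∀ j, A j ≤ 1) {m : ℕ} {η e : ℝ} (hη : 0 < η) (hη1 : η < 1)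
    (he : 0 ≤ e)
    (h : ∀ j < m, A j < A (j + 1) →
      profile P N (ρ (j + 1) + e) ≤ A j ∧ (2 : ℝ) ^ (-e) ≤ η * (A (j + 1) - A j)) :
    √(1 - η) * ∑ j ∈ Finset.range m,
      √((A (j + 1) - A j) * (levelMass Q (ρ (j + 1)) - levelMass Q (ρ j))) ≤
      maxFidelityD P Q N := by
  classical
  let B : ℕ → Finset Y := fun j =>
    Finset.univ.filter fun y => (2 : ℝ) ^ (-ρ (j + 1)) ≤ Q y ∧ Q y < 2 ^ (-ρ j)
  let q : ℕ → ℝ := fun j => ∑ y ∈ B j, Q y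
  have hq : ∀ j, q j = levelMass Q (ρ (j + 1)) - levelMass Q (ρ j) := fun j =>
    sum_bin_eq Q (hρ (Nat.le_succ j))
  have hB : ∀ i j y, y ∈ B i → y ∈ B j → i = j := by
    have key : ∀ i j y, y ∈ B i → y ∈ B j → ¬ i < j := by
      intro i j y hi hj hij
      have h1 := (Finset.mem_filter.1 hi).2.1
      have h2 := (Finset.mem_filter.1 hj).2.2
      have h3 : (2 : ℝ) ^ (-ρ j) ≤ 2 ^ (-ρ (i + 1)) :=
        Real.rpow_le_rpow_of_exponent_le one_le_two (neg_le_neg (hρ hij))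
      linarith
    intro i j y hi hj
    rcases lt_trichotomy i j with h1 | h1 | h1
    · exact absurd h1 (key _ _ _ hi hj)
    · exact h1
    · exact absurd h1 (key _ _ _ hj hi)
  -- Only the points in bins that receive mass; the image must avoid all others to fit into the
  -- storage.
  let s : Finset Y := Finset.univ.filter fun y => ∃ j < m, y ∈ B j ∧ A j < A (j + 1)
  have hs : ∀ y, ∃ j, y ∈ s → j < m ∧ y ∈ B j ∧ A j < A (j + 1) := by
    intro y
    by_cases hy : y ∈ s
    · obtain ⟨j, hj⟩ := (Finset.mem_filter.1 hy).2
      exact ⟨j, fun _ => hj⟩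
    · exact ⟨0, fun h => absurd h hy⟩
  choose J hJ using hs
  simp only [← hq]
  have hfib : ∀ j < m, A j < A (j + 1) → (s.filter fun y => J y = j) = B j := by
    intro j hj hlt
    ext y
    rw [Finset.mem_filter]
    constructor
    · rintro ⟨hy, rfl⟩; exact (hJ y hy).2.1
    · intro hy
      have hys : y ∈ s := Finset.mem_filter.2 ⟨Finset.mem_univ _, j, hj, hy, hlt⟩
      exact ⟨hys, hB _ _ y (hJ y hys).2.1 hy⟩
  -- In bin `j` the point `y` is to receive `(A (j + 1) - A j) * Q y / q j`; its square root times
  -- `√(Q y)` is `c j * Q y`.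
  let c : ℕ → ℝ := fun j => √((A (j + 1) - A j) / q j)
  have hq0 : ∀ j, 0 ≤ q j := fun j => Finset.sum_nonneg fun y _ => hQ.1 y
  have hsum : ∑ j ∈ Finset.range m, √((A (j + 1) - A j) * q j) ≤ ∑ y ∈ s, c (J y) * Q y := by
    rw [← Finset.sum_fiberwise_of_maps_to (t := Finset.range m) (g := J)
      (fun y hy => Finset.mem_range.2 (hJ y hy).1)]
    refine Finset.sum_le_sum fun j hj => ?_
    have hj' := Finset.mem_range.1 hj
    by_cases hlt : A j < A (j + 1)
    · rw [hfib j hj' hlt]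
      have : ∑ y ∈ B j, c (J y) * Q y = c j * q j := by
        rw [Finset.mul_sum]
        refine Finset.sum_congr rfl fun y hy => ?_
        rw [← hfib j hj' hlt, Finset.mem_filter] at hy
        rw [hy.2]
      rw [this]
      rcases (hq0 j).eq_or_lt with h0 | h0
      · rw [← h0]; simp
      · apply le_of_eq
        simp only [c]
        rw [Real.sqrt_mul (sub_nonneg.2 hlt.le), Real.sqrt_div (sub_nonneg.2 hlt.le), div_mul_eq_mul_div,
          eq_div_iff (Real.sqrt_ne_zero'.2 h0), mul_assoc, Real.mul_self_sqrt h0.le]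
    · have h1 : A (j + 1) - A j = 0 := by
        have := hA (Nat.le_succ j); linarith
      rw [h1, zero_mul, Real.sqrt_zero]
      exact Finset.sum_nonneg fun y _ => mul_nonneg (Real.sqrt_nonneg _) (hQ.1 y)
  refine (mul_le_mul_of_nonneg_left hsum (Real.sqrt_nonneg _)).trans ?_
  rcases s.eq_empty_or_nonempty with hempty | hne
  · rw [hempty]; simpa using maxFidelityD_nonneg P Q N
  have hQpos : ∀ y ∈ s, 0 < Q y := fun y hy =>
    lt_of_lt_of_le (by positivity) (Finset.mem_filter.1 (hJ y hy).2.1).2.1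
  have hqpos : ∀ y ∈ s, 0 < q (J y) := fun y hy =>
    (hQpos y hy).trans_le (Finset.single_le_sum (fun y _ => hQ.1 y) (hJ y hy).2.1)
  have hq1 : ∀ j, q j ≤ 1 := fun j => by
    rw [← hQ.2]
    exact Finset.sum_le_sum_of_subset_of_nonneg (Finset.subset_univ _) fun y _ _ => hQ.1 y
  let idx := Fintype.equivFin Y
  -- The mass preceding `y` in its bin, in an arbitrary order; it positions the interval of `y`
  -- inside `[A j, A (j + 1)]`.
  let D : Y → ℝ := fun y => ∑ z ∈ B (J y) with idx z < idx y, Q z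
  have hD0 : ∀ y, 0 ≤ D y := fun y => Finset.sum_nonneg fun z _ => hQ.1 z
  have hDq : ∀ y ∈ s, D y + Q y ≤ q (J y) := by
    intro y hy
    have : D y + Q y = ∑ z ∈ insert y ((B (J y)).filter fun z => idx z < idx y), Q z := by
      rw [Finset.sum_insert (by simp), add_comm]
    rw [this]
    refine Finset.sum_le_sum_of_subset_of_nonneg ?_ fun z _ _ => hQ.1 z
    exact Finset.insert_subset (hJ y hy).2.1 (Finset.filter_subset _ _)
  have hDD : ∀ y ∈ s, ∀ z ∈ s, J y = J z → idx y < idx z → D y + Q y ≤ D z := by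
    intro y hy z hz hyz hlt
    have : D y + Q y = ∑ z ∈ insert y ((B (J y)).filter fun z => idx z < idx y), Q z := by
      rw [Finset.sum_insert (by simp), add_comm]
    rw [this]
    refine Finset.sum_le_sum_of_subset_of_nonneg ?_ fun z _ _ => hQ.1 z
    refine Finset.insert_subset ?_ fun x hx => ?_
    · rw [Finset.mem_filter, ← hyz]
      exact ⟨(hJ y hy).2.1, hlt⟩
    · rw [Finset.mem_filter] at hx ⊢
      rw [← hyz]
      exact ⟨hx.1, hx.2.trans hlt⟩
  let a : Y → ℝ := fun y => A (J y + 1) - A (J y)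
  have ha : ∀ y ∈ s, 0 < a y := fun y hy => sub_pos.2 (hJ y hy).2.2
  let w : Y → ℝ := fun y => a y * (Q y / q (J y))
  let l : Y → ℝ := fun y => A (J y) + a y * (D y / q (J y))
  have hw : ∀ y ∈ s, 0 < w y := fun y hy =>
    mul_pos (ha y hy) (div_pos (hQpos y hy) (hqpos y hy))
  have hAl : ∀ y ∈ s, A (J y) ≤ l y := fun y hy =>
    le_add_of_nonneg_right (mul_nonneg (ha y hy).le (div_nonneg (hD0 y) (hq0 _)))
  have hlw : ∀ y ∈ s, l y + w y ≤ A (J y + 1) := by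
    intro y hy
    have h1 : (D y + Q y) / q (J y) ≤ 1 := (div_le_one (hqpos y hy)).2 (hDq y hy)
    have h2 : l y + w y = A (J y) + a y * ((D y + Q y) / q (J y)) := by
      simp only [l, w]; ring
    rw [h2]
    have := mul_le_mul_of_nonneg_left h1 (ha y hy).le
    simp only [a] at this ⊢
    linarith
  have hdisj : ∀ y ∈ s, ∀ y' ∈ s, y ≠ y' → l y + w y ≤ l y' ∨ l y' + w y' ≤ l y := by
    have key : ∀ y ∈ s, ∀ z ∈ s, J y = J z → idx y < idx z → l y + w y ≤ l z := by
      intro y hy z hz hyz hlt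
      have h2 : l y + w y = A (J y) + a y * ((D y + Q y) / q (J y)) := by
        simp only [l, w]; ring
      have h3 : l z = A (J y) + a y * (D z / q (J y)) := by
        simp only [l, a, hyz]
      rw [h2, h3]
      have := ha y hy
      have := hqpos y hy
      have := hDD y hy z hz hyz hlt
      gcongr
    intro y hy z hz hyz
    rcases lt_trichotomy (J y) (J z) with h1 | h1 | h1
    · exact Or.inl ((hlw y hy).trans ((hA h1).trans (hAl z hz)))
    · rcases lt_trichotomy (idx y) (idx z) with h2 | h2 | h2
      · exact Or.inl (key y hy z hz h1 h2)
      · exact absurd (idx.injective h2) hyz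
      · exact Or.inr (key z hz y hy h1.symm h2)
    · exact Or.inr ((hlw z hz).trans ((hA h1).trans (hAl y hy)))
  -- The tolerance is the fraction `η` of each weight. A source point heavier than `η * w y` has
  -- probability at least `2 ^ (-(ρ (j + 1) + e))`, because `Q y / q j ≥ Q y ≥ 2 ^ (-ρ (j + 1))`.
  -- Such points weigh at most the profile, hence at most `A j ≤ l y`.
  obtain ⟨f, hf, hpush⟩ := exists_push_ge hP hne (l := l) (w := w) (η := fun y => η * w y)
    (fun y hy => (hA0.trans (hA (Nat.zero_le _))).trans (hAl y hy)) (fun y hy => (hw y hy).le)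
    (fun y hy => mul_nonneg hη.le (hw y hy).le) (fun y hy => (hlw y hy).trans (hA1 _)) hdisj (by
      intro y hy
      obtain ⟨hjm, hyB, hlt⟩ := hJ y hy
      obtain ⟨h1, h2⟩ := h _ hjm hlt
      refine le_trans ?_ ((le_max_left _ _).trans (h1.trans (hAl y hy)))
      refine Finset.sum_le_sum_of_subset_of_nonneg (fun x hx => ?_) fun x _ _ => hP.1 x
      rw [Finset.mem_filter] at hx ⊢
      refine ⟨hx.1, le_trans ?_ hx.2.le⟩
      have h3 : Q y ≤ Q y / q (J y) := by
        rw [le_div_iff₀ (hqpos y hy)]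
        exact mul_le_of_le_one_right (hQ.1 y) (hq1 _)
      rw [neg_add, Real.rpow_add two_pos, mul_comm]
      calc (2 : ℝ) ^ (-e) * 2 ^ (-ρ (J y + 1)) ≤ (η * a y) * (Q y / q (J y)) :=
            mul_le_mul h2 ((Finset.mem_filter.1 hyB).2.1.trans h3) (by positivity)
              (mul_nonneg hη.le (ha y hy).le)
        _ = η * w y := by simp only [w]; ring)
  -- A bin reaching beyond level `N` would have profile `1`, forcing `1 ≤ A j < A (j + 1) ≤ 1`. So
  -- all points used have probability at least `2 ^ (-N)`.
  have hcard : s.card ≤ 2 ^ N := by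
    have h1 := card_level_le hQ (N : ℝ)
    rw [Real.rpow_natCast] at h1
    have h2 : s ⊆ Finset.univ.filter fun y => (2 : ℝ) ^ (-(N : ℝ)) ≤ Q y := by
      intro y hy
      obtain ⟨hjm, hyB, hlt⟩ := hJ y hy
      have h3 := (h _ hjm hlt).1
      rw [Finset.mem_filter]
      refine ⟨Finset.mem_univ _, le_trans ?_ (Finset.mem_filter.1 hyB).2.1⟩
      refine Real.rpow_le_rpow_of_exponent_le one_le_two (neg_le_neg ?_)
      by_contra hN
      have h4 : (1 : ℝ) ≤ profile P N (ρ (J y + 1) + e) := by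
        refine le_trans (le_of_eq ?_) (le_max_right _ _)
        rw [if_pos (by linarith [not_le.1 hN])]
      linarith [hA1 (J y + 1)]
    exact_mod_cast (Nat.cast_le.2 (Finset.card_le_card h2)).trans h1
  refine le_trans ?_ (le_maxFidelityD hP hQ (fidelity_push_mem_fidelitiesD P Q hne hcard hf))
  rw [fidelity, Finset.mul_sum]
  refine le_trans (Finset.sum_le_sum fun y hy => ?_) (Finset.sum_le_sum_of_subset_of_nonneg
    (Finset.subset_univ s) fun y _ _ => mul_nonneg (Real.sqrt_nonneg _) (Real.sqrt_nonneg _))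
  have h1 : (1 - η) * w y ≤ push f P y := by
    have := hpush y hy
    linarith
  refine le_trans (le_of_eq ?_) (mul_le_mul_of_nonneg_right (Real.sqrt_le_sqrt h1)
    (Real.sqrt_nonneg (Q y)))
  have h2 : w y = (a y / q (J y)) * Q y := by simp only [w]; ring
  have h3 : 0 ≤ a y / q (J y) := div_nonneg (ha y hy).le (hq0 _)
  rw [Real.sqrt_mul (by linarith), h2, Real.sqrt_mul h3, mul_assoc, mul_assoc,
    Real.mul_self_sqrt (hQ.1 y)]

/-- Converse for majorization conversion. -/
theorem exists_le_of_mem_fidelitiesM {P : X → ℝ} (hP : P ∈ stdSimplex ℝ X) {Q : Y → ℝ}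
    (hQ : Q ∈ stdSimplex ℝ Y) {N : ℕ} {r : ℝ} (hr : r ∈ fidelitiesM P Q N) {ρ : ℕ → ℝ}
    (hρ : Monotone ρ) (m : ℕ) :
    ∃ A : ℕ → ℝ, Monotone A ∧ (∀ j, A j ∈ Set.Icc (0 : ℝ) 1) ∧ (∀ j, profile P N (ρ j) ≤ A j) ∧
      r ≤ √(A 0 * topSum Q ⌊(2 : ℝ) ^ ρ 0⌋₊) + ∑ j ∈ Finset.range m,
        √((A (j + 1) - A j) * (topSum Q ⌊(2 : ℝ) ^ ρ (j + 1)⌋₊ - topSum Q ⌊(2 : ℝ) ^ ρ j⌋₊)) +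
        √((1 - A m) * (1 - topSum Q ⌊(2 : ℝ) ^ ρ m⌋₊)) := by
  obtain ⟨P', hP', P'', hP'', h1, h2, rfl⟩ := hr
  have hm : Monotone fun j => ⌊(2 : ℝ) ^ ρ j⌋₊ := fun i j hij =>
    Nat.floor_mono (Real.rpow_le_rpow_of_exponent_le one_le_two (hρ hij))
  exact ⟨fun j => topSum P'' ⌊(2 : ℝ) ^ ρ j⌋₊, (topSum_mono hP''.1).comp hm,
    fun j => ⟨topSum_nonneg hP''.1 _, (topSum_le_sum hP''.1 _).trans hP''.2.le⟩,
    fun j => profile_le_topSum hP hP' hP''.1 h1 h2 _, fidelity_le_of_monotone hP'' hQ hm m⟩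

end Quantile

/-! ### The central limit theorem for level masses; normal distribution functions. -/

section CentralLimit

open MeasureTheory ProbabilityTheory

variable {Y : Type*} [Fintype Y]

/-- The variance of `-logb 2 (Q y)` under `Q`. -/
noncomputable def varentropy (Q : Y → ℝ) : ℝ :=
  ∑ y, Q y * (-Real.logb 2 (Q y) - shannonEntropy Q) ^ 2

/-- The distribution function of the centered normal distribution of variance `v` (the unit step
if `v = 0`). -/
noncomputable def normalCdf (v : ℝ) (x : ℝ) : ℝ := cdf (gaussianReal 0 v.toNNReal) x

theorem sum_measure_eq_levelMass [MeasurableSpace Y] [MeasurableSingletonClass Y] {Q : Y → ℝ}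
    (hQ : Q ∈ stdSimplex ℝ Y) {μ : Measure Y} [IsProbabilityMeasure μ]
    (hμ : ∀ y, μ.real {y} = Q y) (L : ℕ) (r : ℝ) :
    (Measure.infinitePi fun _ : ℕ => μ).real
      {ω | ∑ k ∈ Finset.range L, -Real.logb 2 (Q (ω k)) ≤ r} = levelMass (iid Q L) r := by
  classical
  set P : Measure (ℕ → Y) := Measure.infinitePi fun _ : ℕ => μ with hP
  have hind : iIndepFun (fun (i : Fin L) (ω : ℕ → Y) => ω i) P :=
    (iIndepFun_infinitePi (X := fun _ (y : Y) => y) (fun _ => measurable_id)).precomp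
      Fin.val_injective
  have hm : ∀ i : Fin L, Measurable fun ω : ℕ → Y => ω i := fun i => measurable_pi_apply _
  have hmap := (iIndepFun_iff_map_fun_eq_pi_map fun i => (hm i).aemeasurable).1 hind
  have hmap' : P.map (fun ω (i : Fin L) => ω i) = Measure.pi fun _ => μ := by
    rw [hmap]
    congr 1
    funext i
    exact Measure.infinitePi_map_eval (fun _ : ℕ => μ) _
  have hset : {ω : ℕ → Y | ∑ k ∈ Finset.range L, -Real.logb 2 (Q (ω k)) ≤ r} =
      (fun ω (i : Fin L) => ω i) ⁻¹' {y | ∑ i, -Real.logb 2 (Q (y i)) ≤ r} := by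
    ext ω
    simp [Finset.sum_range]
  rw [hset, ← map_measureReal_apply (measurable_pi_lambda _ fun i => hm i) (Set.toFinite _).measurableSet,
    hmap']
  have h1 := sum_measureReal_singleton (μ := Measure.pi fun _ : Fin L => μ)
    (Finset.univ.filter fun y : Fin L → Y => ∑ i, -Real.logb 2 (Q (y i)) ≤ r)
  rw [Finset.coe_filter] at h1
  simp only [Finset.mem_univ, true_and] at h1
  rw [← h1]
  have h2 : ∀ y : Fin L → Y, (Measure.pi fun _ : Fin L => μ).real {y} = iid Q L y := by
    intro y
    rw [measureReal_def, Measure.pi_singleton, ENNReal.toReal_prod]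
    exact Finset.prod_congr rfl fun i _ => hμ _
  simp only [h2, levelMass]
  rw [Finset.sum_filter, Finset.sum_filter]
  refine Finset.sum_congr rfl fun y _ => ?_
  -- Since `Real.logb 2 0 = 0`, the two conditions may disagree at points of probability zero, but
  -- these contribute nothing.
  rcases ((iid_mem_stdSimplex hQ L).1 y).eq_or_lt with h0 | h0
  · simp [← h0]
  · have hne : ∀ i, Q (y i) ≠ 0 := fun i hi => h0.ne' (Finset.prod_eq_zero (Finset.mem_univ i) hi)
    have h3 : ∑ i, -Real.logb 2 (Q (y i)) = -Real.logb 2 (iid Q L y) := by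
      rw [Finset.sum_neg_distrib, iid, Real.logb_prod _ _ fun i _ => hne i]
    have h4 : (2 : ℝ) ^ (-r) ≤ iid Q L y ↔ ∑ i, -Real.logb 2 (Q (y i)) ≤ r := by
      rw [h3, neg_le, Real.le_logb_iff_rpow_le one_lt_two h0]
    simp only [h4]

/-- The only possible atom is at `0`, when the variance vanishes. This is the source of the
condition "positive variance or nonzero argument" in the limits below. -/
theorem frontier_Iic_null {v : NNReal} {x : ℝ} (h : v ≠ 0 ∨ x ≠ 0) :
    gaussianReal 0 v {x} = 0 := by
  by_cases hv : v = 0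
  · have hx : x ≠ 0 := h.resolve_left (fun h => h hv)
    simp [hv, hx.symm]
  · have := nullSingletonClass_gaussianReal (μ := 0) hv
    exact measure_singleton x

/-- The level mass is the probability that a sum of independent copies of `-logb 2 (Q ·)` stays
below the level. These have mean `shannonEntropy Q` and variance `varentropy Q`, and `x` is not an
atom of the limit law. -/
theorem tendsto_levelMass_iid_aux {Q : Y → ℝ} (hQ : Q ∈ stdSimplex ℝ Y) {x : ℝ}
    (hx : 0 < varentropy Q ∨ x ≠ 0) :
    Tendsto (fun n : ℕ => levelMass (iid Q n) (n * shannonEntropy Q + x * √(n : ℝ))) atTop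
      (𝓝 (normalCdf (varentropy Q) x)) := by
  let _ : MeasurableSpace Y := ⊤
  have hsum : ∑ y, ENNReal.ofReal (Q y) = 1 := by
    rw [← ENNReal.ofReal_sum_of_nonneg fun y _ => hQ.1 y, hQ.2, ENNReal.ofReal_one]
  let p := PMF.ofFintype (fun y => ENNReal.ofReal (Q y)) hsum
  let μ : Measure Y := p.toMeasure
  have hp : ∀ y, (p y).toReal = Q y := fun y => ENNReal.toReal_ofReal (hQ.1 y)
  have hμ : ∀ y, μ.real {y} = Q y := by
    intro y
    rw [measureReal_def, PMF.toMeasure_apply_singleton _ _ (measurableSet_singleton y), hp]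
  set P : Measure (ℕ → Y) := Measure.infinitePi fun _ : ℕ => μ with hP
  let Z : Y → ℝ := fun y => -Real.logb 2 (Q y)
  have hZ : Measurable Z := measurable_from_top
  let X : ℕ → (ℕ → Y) → ℝ := fun i ω => Z (ω i)
  have hlaw : ∀ i, MeasurePreserving (Function.eval i) P μ := fun i =>
    measurePreserving_eval_infinitePi (fun _ : ℕ => μ) i
  have hmean : P[X 0] = shannonEntropy Q := by
    have h1 : P[X 0] = ∫ y, Z y ∂μ := by
      rw [← (hlaw 0).map_eq, integral_map (hlaw 0).measurable.aemeasurable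
        hZ.aestronglyMeasurable]
    rw [h1, PMF.integral_eq_sum]
    simp [hp, Z, shannonEntropy]
  have hvar : Var[X 0; P] = varentropy Q := by
    have h0 : AEMeasurable (X 0) P := (hZ.comp (hlaw 0).measurable).aemeasurable
    rw [variance_eq_integral h0, hmean]
    have h1 : ∫ ω, (X 0 ω - shannonEntropy Q) ^ 2 ∂P = ∫ y, (Z y - shannonEntropy Q) ^ 2 ∂μ := by
      rw [← (hlaw 0).map_eq, integral_map (hlaw 0).measurable.aemeasurable]
      exact (measurable_from_top : Measurable fun y =>
          (Z y - shannonEntropy Q) ^ 2).aestronglyMeasurable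
    rw [h1, PMF.integral_eq_sum]
    simp [hp, Z, varentropy]
  have hindep : iIndepFun X P := iIndepFun_infinitePi (X := fun _ => Z) fun _ => hZ
  have hident : ∀ i, IdentDistrib (X i) (X 0) P P := fun i => by
    have h1 : IdentDistrib (Function.eval i : (ℕ → Y) → Y) (Function.eval 0) P P :=
      ⟨(hlaw i).measurable.aemeasurable, (hlaw 0).measurable.aemeasurable, by
        rw [(hlaw i).map_eq, (hlaw 0).map_eq]⟩
    exact h1.comp hZ
  have hmem : MemLp (X 0) 2 P := by
    have : MemLp Z 2 μ := MemLp.of_discrete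
    exact this.comp_measurePreserving (hlaw 0)
  have hclt := (tendstoInDistribution_inv_sqrt_mul_sum_sub (P := P) (X := X)
    (Y := id) (P' := gaussianReal 0 Var[X 0; P].toNNReal) HasLaw.id hmem hindep hident).tendsto
  have hfr : gaussianReal 0 (Var[X 0; P].toNNReal) {x} = 0 := by
    refine frontier_Iic_null (hx.imp_left fun h => ?_)
    rw [hvar]
    simpa using h
  have h2 := ProbabilityMeasure.tendsto_measure_of_null_frontier_of_tendsto' hclt (E := Set.Iic x)
    (by rw [frontier_Iic]; simpa using hfr)
  simp only [ProbabilityMeasure.coe_mk, Measure.map_id] at h2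
  have h3 := (ENNReal.tendsto_toReal (measure_ne_top _ _)).comp h2
  have h4 : (gaussianReal 0 (Var[X 0; P].toNNReal) (Set.Iic x)).toReal =
      normalCdf (varentropy Q) x := by
    rw [normalCdf, cdf_eq_real, hvar]; rfl
  rw [h4] at h3
  refine h3.congr' ?_
  filter_upwards [eventually_ge_atTop 1] with n hn
  have hn' : 0 < √(n : ℝ) := Real.sqrt_pos.2 (by exact_mod_cast hn)
  have hmeas : Measurable fun ω : ℕ → Y =>
      (√(n : ℝ))⁻¹ * (∑ k ∈ Finset.range n, X k ω - n * P[X 0]) := by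
    refine Measurable.const_mul (Measurable.sub_const ?_ _) _
    exact Finset.measurable_fun_sum _ fun k _ => hZ.comp (hlaw k).measurable
  rw [← sum_measure_eq_levelMass hQ hμ]
  simp only [Function.comp]
  rw [Measure.map_apply hmeas measurableSet_Iic, measureReal_def]
  congr 2
  ext ω
  simp only [Set.mem_preimage, Set.mem_Iic, Set.mem_ofPred_eq, hmean, X, Z]
  rw [inv_mul_le_iff₀ hn', sub_le_iff_le_add]
  constructor <;> intro h <;> linarith

theorem normalCdf_nonneg (v x : ℝ) : 0 ≤ normalCdf v x := cdf_nonneg _ _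

theorem normalCdf_le_one (v x : ℝ) : normalCdf v x ≤ 1 := cdf_le_one _ _

theorem normalCdf_mono (v : ℝ) : Monotone (normalCdf v) := monotone_cdf _

theorem tendsto_normalCdf_atBot (v : ℝ) : Tendsto (normalCdf v) atBot (𝓝 0) := tendsto_cdf_atBot _

theorem tendsto_normalCdf_atTop (v : ℝ) : Tendsto (normalCdf v) atTop (𝓝 1) := tendsto_cdf_atTop _

theorem normalCdf_zero (x : ℝ) : normalCdf 0 x = if 0 ≤ x then 1 else 0 := by
  rw [normalCdf, cdf_eq_real, measureReal_def]
  simp only [Real.toNNReal_zero, gaussianReal_zero_var]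
  rw [Measure.dirac_apply' _ measurableSet_Iic]
  by_cases h : 0 ≤ x <;> simp [Set.indicator, h]

theorem ofReal_normalCdf_sub (v a b : ℝ) :
    ENNReal.ofReal (normalCdf v b - normalCdf v a) = gaussianReal 0 v.toNNReal (Set.Ioc a b) := by
  conv_rhs => rw [← measure_cdf (gaussianReal 0 v.toNNReal)]
  rw [StieltjesFunction.measure_Ioc]
  rfl

theorem gaussianReal_Ioc_pos {v : ℝ} (hv : 0 < v) {a b : ℝ} (h : a < b) :
    0 < gaussianReal 0 v.toNNReal (Set.Ioc a b) := by
  have hv' : v.toNNReal ≠ 0 := by simpa using hv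
  have hpos : 0 < volume (Set.Ioc a b) := by simpa using h
  have := gaussianReal_absolutelyContinuous' 0 hv'
  by_contra h0
  exact hpos.ne' (this (le_antisymm (not_lt.1 h0) zero_le))

/-- For `v > 0` the Gaussian charges every interval; for `v = 0` the hypotheses force `a < 0 ≤ b`.
-/
theorem normalCdf_lt {v : ℝ} (hv : 0 ≤ v) {a b : ℝ} (h : a < b) (ha : normalCdf v a < 1)
    (hb : 0 < normalCdf v b) : normalCdf v a < normalCdf v b := by
  rcases hv.eq_or_lt with h0 | h0
  · subst h0
    rw [normalCdf_zero] at ha hb ⊢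
    rw [normalCdf_zero]
    split_ifs at ha hb ⊢ <;> linarith
  · have := gaussianReal_Ioc_pos h0 h
    rw [← ofReal_normalCdf_sub, ENNReal.ofReal_pos] at this
    linarith

theorem continuousAt_normalCdf {v x : ℝ} (h : 0 < v ∨ x ≠ 0) : ContinuousAt (normalCdf v) x := by
  have h0 : gaussianReal 0 v.toNNReal {x} = 0 :=
    frontier_Iic_null (h.imp_left fun h => by simpa using h)
  rw [← measure_cdf (gaussianReal 0 v.toNNReal), StieltjesFunction.measure_singleton,
    ENNReal.ofReal_eq_zero] at h0
  have hmono := monotone_cdf (gaussianReal 0 v.toNNReal)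
  refine continuousAt_iff_continuous_left'_right'.2 ⟨?_, ?_⟩
  · refine (hmono.continuousWithinAt_Iio_iff_leftLim_eq).2 (le_antisymm (hmono.leftLim_le le_rfl) ?_)
    change cdf _ x ≤ _
    linarith
  · exact ((cdf (gaussianReal 0 v.toNNReal)).right_continuous x).mono Set.Ioi_subset_Ici_self

/-- By monotonicity `f n (u n)` is squeezed by the values at fixed points on either side of `y`,
where `G` is close to `G y`. -/
theorem tendsto_apply_of_monotone {f : ℕ → ℝ → ℝ} (hf : ∀ n, Monotone (f n)) {G : ℝ → ℝ}
    {y : ℝ} (hG : ContinuousAt G y)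
    (hfG : ∀ᶠ x in 𝓝 y, Tendsto (fun n => f n x) atTop (𝓝 (G x))) {u : ℕ → ℝ}
    (hu : Tendsto u atTop (𝓝 y)) : Tendsto (fun n => f n (u n)) atTop (𝓝 (G y)) := by
  refine tendsto_order.2 ⟨fun a ha => ?_, fun a ha => ?_⟩
  · have h1 : ∀ᶠ x in 𝓝[<] y, a < G x ∧ Tendsto (fun n => f n x) atTop (𝓝 (G x)) ∧ x < y :=
      (((hG.eventually (lt_mem_nhds ha)).and hfG).filter_mono nhdsWithin_le_nhds).and
        self_mem_nhdsWithin |>.mono fun x h => ⟨h.1.1, h.1.2, h.2⟩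
    obtain ⟨x, h2, h3, h4⟩ := h1.exists
    filter_upwards [h3.eventually (lt_mem_nhds h2), hu.eventually (lt_mem_nhds h4)] with n h5 h6
    exact h5.trans_le (hf n h6.le)
  · have h1 : ∀ᶠ x in 𝓝[>] y, G x < a ∧ Tendsto (fun n => f n x) atTop (𝓝 (G x)) ∧ y < x :=
      (((hG.eventually (gt_mem_nhds ha)).and hfG).filter_mono nhdsWithin_le_nhds).and
        self_mem_nhdsWithin |>.mono fun x h => ⟨h.1.1, h.1.2, h.2⟩
    obtain ⟨x, h2, h3, h4⟩ := h1.exists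
    filter_upwards [h3.eventually (gt_mem_nhds h2), hu.eventually (gt_mem_nhds h4)] with n h5 h6
    exact (hf n h6.le).trans_lt h5

theorem eventually_pos_or_ne {v y : ℝ} (hy : 0 < v ∨ y ≠ 0) : ∀ᶠ x in 𝓝 y, 0 < v ∨ x ≠ 0 := by
  rcases hy with h | h
  · exact Eventually.of_forall fun _ => Or.inl h
  · filter_upwards [isOpen_ne.mem_nhds h] with x hx using Or.inr hx

theorem tendsto_levelMass_iid {Q : Y → ℝ} (hQ : Q ∈ stdSimplex ℝ Y) {L : ℕ → ℕ}
    (hL : Tendsto L atTop atTop) {r : ℕ → ℝ} {y : ℝ} (hy : 0 < varentropy Q ∨ y ≠ 0)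
    (hr : Tendsto (fun n => (r n - L n * shannonEntropy Q) / √(L n : ℝ)) atTop (𝓝 y)) :
    Tendsto (fun n => levelMass (iid Q (L n)) (r n)) atTop (𝓝 (normalCdf (varentropy Q) y)) := by
  refine (tendsto_apply_of_monotone
    (f := fun n x => levelMass (iid Q (L n)) (L n * shannonEntropy Q + x * √(L n : ℝ)))
    (fun n x x' h => levelMass_mono (iid_mem_stdSimplex hQ _).1 (by gcongr))
    (continuousAt_normalCdf hy)
    ((eventually_pos_or_ne hy).mono fun x hx => (tendsto_levelMass_iid_aux hQ hx).comp hL)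
    hr).congr' ?_
  filter_upwards [hL.eventually (eventually_ge_atTop 1)] with n hn
  have hn' : 0 < √(L n : ℝ) := Real.sqrt_pos.2 (by exact_mod_cast hn)
  rw [div_mul_cancel₀ _ hn'.ne']
  congr 1
  ring

theorem varentropy_nonneg {Q : Y → ℝ} (hQ : Q ∈ stdSimplex ℝ Y) : 0 ≤ varentropy Q :=
  Finset.sum_nonneg fun y _ => mul_nonneg (hQ.1 y) (sq_nonneg _)

/-- Zero variance would make `logb 2 ∘ Q` constant on the support. -/
theorem varentropy_pos {Q : Y → ℝ} (hQ : Q ∈ stdSimplex ℝ Y) (h : ¬ UniformOnSupport Q) :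
    0 < varentropy Q := by
  refine (varentropy_nonneg hQ).lt_of_ne fun h0 => h fun y y' hy hy' => ?_
  have h1 := (Finset.sum_eq_zero_iff_of_nonneg fun y _ =>
    mul_nonneg (hQ.1 y) (sq_nonneg (-Real.logb 2 (Q y) - shannonEntropy Q))).1 h0.symm
  have h2 : ∀ z, 0 < Q z → Real.logb 2 (Q z) = -shannonEntropy Q := by
    intro z hz
    have := h1 z (Finset.mem_univ z)
    rcases mul_eq_zero.1 this with h3 | h3
    · exact absurd h3 hz.ne'
    · have := pow_eq_zero_iff (two_ne_zero) |>.1 h3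
      linarith
  exact Real.logb_injOn_pos one_lt_two hy hy' ((h2 y hy).trans (h2 y' hy').symm)

theorem shannonEntropy_nonneg {Q : Y → ℝ} (hQ : Q ∈ stdSimplex ℝ Y) : 0 ≤ shannonEntropy Q := by
  rw [shannonEntropy, ← Finset.sum_neg_distrib]
  refine Finset.sum_nonneg fun y _ => ?_
  have h1 : Q y ≤ 1 := by
    rw [← hQ.2]
    exact Finset.single_le_sum (fun y _ => hQ.1 y) (Finset.mem_univ y)
  have := Real.logb_nonpos one_lt_two (hQ.1 y) h1
  nlinarith [hQ.1 y]

end CentralLimit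

/-! ### Limits on the scale `√n` for storage, source and target. -/

section Asymptotic

/-! ### Sizes -/

theorem tendsto_sqrt_natCast_atTop : Tendsto (fun n : ℕ => √(n : ℝ)) atTop atTop :=
  Real.tendsto_sqrt_atTop.comp tendsto_natCast_atTop_atTop

theorem eventually_size_nonneg {a : ℝ} (ha : 0 < a) (b : ℝ) :
    ∀ᶠ n : ℕ in atTop, 0 ≤ a * n + b * √(n : ℝ) := by
  have h1 : Tendsto (fun n : ℕ => a * √(n : ℝ)) atTop atTop :=
    tendsto_sqrt_natCast_atTop.const_mul_atTop ha
  filter_upwards [h1.eventually (eventually_ge_atTop (-b))] with n hn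
  have h2 : a * (n : ℝ) + b * √(n : ℝ) = √(n : ℝ) * (a * √(n : ℝ) + b) := by
    rw [mul_add, mul_comm b, mul_left_comm, Real.mul_self_sqrt (Nat.cast_nonneg n)]
  rw [h2]
  exact mul_nonneg (Real.sqrt_nonneg _) (by linarith)

theorem tendsto_size_sub {a : ℝ} (ha : 0 < a) (b : ℝ) :
    Tendsto (fun n : ℕ => ((size a b n : ℝ) - a * n) / √(n : ℝ)) atTop (𝓝 b) := by
  have h0 : Tendsto (fun n : ℕ => b - (√(n : ℝ))⁻¹) atTop (𝓝 b) := by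
    simpa using (tendsto_const_nhds (x := b)).sub
      (tendsto_inv_atTop_zero.comp tendsto_sqrt_natCast_atTop)
  refine tendsto_of_tendsto_of_tendsto_of_le_of_le' h0 tendsto_const_nhds ?_ ?_
  · filter_upwards [eventually_size_nonneg ha b, eventually_ge_atTop 1] with n hn hn1
    have hn' : 0 < √(n : ℝ) := Real.sqrt_pos.2 (by exact_mod_cast hn1)
    have := Nat.sub_one_lt_floor (a * n + b * √(n : ℝ))
    rw [le_div_iff₀ hn', sub_mul, inv_mul_cancel₀ hn'.ne', size]
    linarith
  · filter_upwards [eventually_size_nonneg ha b, eventually_ge_atTop 1] with n hn hn1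
    have hn' : 0 < √(n : ℝ) := Real.sqrt_pos.2 (by exact_mod_cast hn1)
    have := Nat.floor_le hn
    rw [div_le_iff₀ hn', size]
    linarith

theorem tendsto_size_div {a : ℝ} (ha : 0 < a) (b : ℝ) :
    Tendsto (fun n : ℕ => (size a b n : ℝ) / n) atTop (𝓝 a) := by
  have h := ((tendsto_size_sub ha b).mul
    (tendsto_inv_atTop_zero.comp tendsto_sqrt_natCast_atTop)).const_add a
  simp only [mul_zero, add_zero, Function.comp] at h
  refine h.congr' ?_
  filter_upwards [eventually_ge_atTop 1] with n hn
  have hn0 : (0 : ℝ) < n := by exact_mod_cast hn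
  rw [← div_eq_mul_inv, div_div, Real.mul_self_sqrt hn0.le]
  field_simp
  ring

theorem tendsto_size_atTop {a : ℝ} (ha : 0 < a) (b : ℝ) : Tendsto (size a b) atTop atTop := by
  rw [← tendsto_natCast_atTop_iff (R := ℝ)]
  refine ((tendsto_size_div ha b).pos_mul_atTop ha tendsto_natCast_atTop_atTop).congr' ?_
  filter_upwards [eventually_ge_atTop 1] with n hn
  have hn0 : (0 : ℝ) < n := by exact_mod_cast hn
  field_simp

/-- The slack `√(√n)` in exponents is used below: it is negligible against `√n`, while `2 ^
(-√(√n))` still tends to `0`. -/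
theorem tendsto_sqrt_sqrt_div :
    Tendsto (fun n : ℕ => √(√(n : ℝ)) / √(n : ℝ)) atTop (𝓝 0) := by
  refine (tendsto_inv_atTop_zero.comp
    (Real.tendsto_sqrt_atTop.comp tendsto_sqrt_natCast_atTop)).congr' ?_
  filter_upwards [eventually_ge_atTop 1] with n hn
  have hn0 : (0 : ℝ) < √(n : ℝ) := Real.sqrt_pos.2 (by exact_mod_cast hn)
  have hn1 : (0 : ℝ) < √(√(n : ℝ)) := Real.sqrt_pos.2 hn0
  simp only [Function.comp]
  rw [eq_div_iff hn0.ne', inv_mul_eq_iff_eq_mul₀ hn1.ne', Real.mul_self_sqrt hn0.le]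

/-! ### Limits of the profile of the source -/

/-- The properties of the limiting profiles: a distribution function, possibly with total mass `0`,
that is strictly increasing except at the values `0` and `1`. -/
structure IsProfile (S : ℝ → ℝ) : Prop where
  mono : Monotone S
  nonneg : ∀ x, 0 ≤ S x
  le_one : ∀ x, S x ≤ 1
  lt : ∀ ⦃x x'⦄, x < x' → S x < 1 → 0 < S x' → S x < S x'

theorem isProfile_zero : IsProfile fun _ => 0 :=
  ⟨monotone_const, fun _ => le_rfl, fun _ => zero_le_one, fun _ _ _ _ h => absurd h (lt_irrefl _)⟩

theorem isProfile_normalCdf {v : ℝ} (hv : 0 ≤ v) (a : ℝ) :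
    IsProfile fun x => normalCdf v (x - a) :=
  ⟨fun _ _ h => normalCdf_mono v (by linarith), fun _ => normalCdf_nonneg _ _,
    fun _ => normalCdf_le_one _ _, fun _ _ h h1 h2 => normalCdf_lt hv (by linarith) h1 h2⟩

theorem IsProfile.sup {S S' : ℝ → ℝ} (h : IsProfile S) (h' : IsProfile S') :
    IsProfile fun x => max (S x) (S' x) := by
  refine ⟨fun x y hxy => max_le_max (h.mono hxy) (h'.mono hxy), fun x => le_max_of_le_left (h.nonneg x),
    fun x => max_le (h.le_one x) (h'.le_one x), fun x y hxy h1 h2 => ?_⟩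
  rw [max_lt_iff] at h1
  have key : 0 < max (S y) (S' y) → S x < max (S y) (S' y) ∧ S' x < max (S y) (S' y) := by
    intro _
    constructor
    · rcases (h.nonneg y).eq_or_lt with h0 | h0
      · exact ((h.mono hxy.le).trans h0.ge).trans_lt h2
      · exact (h.lt hxy h1.1 h0).trans_le (le_max_left _ _)
    · rcases (h'.nonneg y).eq_or_lt with h0 | h0
      · exact ((h'.mono hxy.le).trans h0.ge).trans_lt h2
      · exact (h'.lt hxy h1.2 h0).trans_le (le_max_right _ _)
  exact max_lt (key h2).1 (key h2).2

/-- Convergence of monotone functions up to an arbitrarily small shift of the argument. -/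
def ShiftTendsto (f : ℕ → ℝ → ℝ) (S : ℝ → ℝ) : Prop :=
  ∀ ⦃x x'⦄, x < x' → (∀ c < S x, ∀ᶠ n in atTop, c ≤ f n x') ∧ ∀ c > S x', ∀ᶠ n in atTop, f n x ≤ c

/-- Between `x` and `x'` there is a point of convergence, and monotonicity does the rest; possible
jumps at `a` and `b` are thus avoided. -/
theorem shiftTendsto_of_tendsto {f : ℕ → ℝ → ℝ} (hf : ∀ n, Monotone (f n)) {S : ℝ → ℝ}
    (hS : Monotone S) (a b : ℝ)
    (h : ∀ x, x ≠ a → x ≠ b → Tendsto (fun n => f n x) atTop (𝓝 (S x))) : ShiftTendsto f S := by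
  intro x x' hxx'
  obtain ⟨z, ⟨hz1, hz2⟩, hz3⟩ : ∃ z ∈ Set.Ioo x x', z ∉ ({a, b} : Finset ℝ) :=
    (Set.Ioo_infinite hxx').exists_notMem_finset _
  simp only [Finset.mem_insert, Finset.mem_singleton, not_or] at hz3
  have hz := h z hz3.1 hz3.2
  refine ⟨fun c hc => ?_, fun c hc => ?_⟩
  · filter_upwards [hz.eventually (lt_mem_nhds (hc.trans_le (hS hz1.le)))] with n hn
    exact hn.le.trans (hf n hz2.le)
  · filter_upwards [hz.eventually (gt_mem_nhds (lt_of_le_of_lt (hS hz2.le) hc))] with n hn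
    exact (hf n hz1.le).trans hn.le

variable {X Y : Type*} [Fintype X] [Fintype Y]

/-- The limiting profile of `n` copies of `P` stored in `s₁ n + s₂ √n` bits, as a function of `x`,
where `2 ^ (min (H P) s₁ * n + x √n)` is the number of values that are summed. -/
noncomputable def limitProfile (P : X → ℝ) (s₁ s₂ : ℝ) (x : ℝ) : ℝ :=
  max (if shannonEntropy P ≤ s₁ then normalCdf (varentropy P) (x - 0) else 0)
    (if s₁ ≤ shannonEntropy P then normalCdf 0 (x - s₂) else 0)

theorem isProfile_limitProfile {P : X → ℝ} (hP : P ∈ stdSimplex ℝ X) (s₁ s₂ : ℝ) :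
    IsProfile (limitProfile P s₁ s₂) := by
  have h1 := isProfile_normalCdf (varentropy_nonneg hP) 0
  have h2 := isProfile_normalCdf le_rfl s₂
  unfold limitProfile
  split_ifs
  · exact h1.sup h2
  · exact h1.sup isProfile_zero
  · exact isProfile_zero.sup h2
  · exact isProfile_zero.sup isProfile_zero

theorem tendsto_limitProfile_atBot (P : X → ℝ) (s₁ s₂ : ℝ) :
    Tendsto (limitProfile P s₁ s₂) atBot (𝓝 0) := by
  have h : ∀ v a : ℝ, Tendsto (fun x => normalCdf v (x - a)) atBot (𝓝 0) := fun v a =>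
    (tendsto_normalCdf_atBot v).comp (tendsto_atBot_add_const_right _ (-a) tendsto_id)
  rw [← max_self (0 : ℝ)]
  refine Tendsto.max ?_ ?_
  · split_ifs
    · exact h _ 0
    · exact tendsto_const_nhds
  · split_ifs
    · exact h 0 s₂
    · exact tendsto_const_nhds

theorem tendsto_limitProfile_atTop {P : X → ℝ} (hP : P ∈ stdSimplex ℝ X) (s₁ s₂ : ℝ) :
    Tendsto (limitProfile P s₁ s₂) atTop (𝓝 1) := by
  have h : ∀ v a : ℝ, Tendsto (fun x => normalCdf v (x - a)) atTop (𝓝 1) := fun v a =>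
    (tendsto_normalCdf_atTop v).comp (tendsto_atTop_add_const_right _ (-a) tendsto_id)
  rcases le_total (shannonEntropy P) s₁ with h1 | h1
  · refine tendsto_of_tendsto_of_tendsto_of_le_of_le (h (varentropy P) 0) tendsto_const_nhds
      (fun x => ?_) (isProfile_limitProfile hP s₁ s₂).le_one
    rw [limitProfile, if_pos h1]
    exact le_max_left _ _
  · refine tendsto_of_tendsto_of_tendsto_of_le_of_le (h 0 s₂) tendsto_const_nhds
      (fun x => ?_) (isProfile_limitProfile hP s₁ s₂).le_one
    rw [limitProfile, if_pos h1]
    exact le_max_right _ _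

/-- For `h < H(P)` the level eventually lies below `n * H(P) + y * √n` for every fixed `y`, so its
mass is at most a normal tail as small as desired. -/
theorem tendsto_source {P : X → ℝ} (hP : P ∈ stdSimplex ℝ X) {h x : ℝ} (hx : x ≠ 0)
    (hh : h ≤ shannonEntropy P) :
    Tendsto (fun n : ℕ => levelMass (iid P n) (h * n + x * √(n : ℝ))) atTop
      (𝓝 (if shannonEntropy P ≤ h then normalCdf (varentropy P) (x - 0) else 0)) := by
  split_ifs with h1
  · obtain rfl := le_antisymm hh h1
    simpa [mul_comm] using tendsto_levelMass_iid_aux hP (Or.inr hx)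
  · have h2 : shannonEntropy P - h > 0 := sub_pos.2 (not_le.1 h1)
    refine tendsto_order.2 ⟨fun a ha => Eventually.of_forall fun n =>
      ha.trans_le (levelMass_nonneg (iid_mem_stdSimplex hP n).1 _), fun a ha => ?_⟩
    obtain ⟨y, hya, hy0⟩ := (((tendsto_normalCdf_atBot (varentropy P)).eventually
      (gt_mem_nhds ha)).and (eventually_lt_atBot 0)).exists
    have h3 : Tendsto (fun n : ℕ => (shannonEntropy P - h) * √(n : ℝ)) atTop atTop :=
      tendsto_sqrt_natCast_atTop.const_mul_atTop h2
    filter_upwards [(tendsto_levelMass_iid_aux hP (Or.inr hy0.ne)).eventually (gt_mem_nhds hya),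
      h3.eventually (eventually_ge_atTop (x - y))] with n hn hn'
    refine (levelMass_mono (iid_mem_stdSimplex hP n).1 ?_).trans_lt hn
    have h4 : (n : ℝ) * shannonEntropy P + y * √(n : ℝ) - (h * n + x * √(n : ℝ)) =
        √(n : ℝ) * ((shannonEntropy P - h) * √(n : ℝ) - (x - y)) := by
      linear_combination (h - shannonEntropy P) * Real.mul_self_sqrt (Nat.cast_nonneg (α := ℝ) n)
    have := mul_nonneg (Real.sqrt_nonneg (n : ℝ)) (sub_nonneg.2 hn')
    linarith

theorem tendsto_storage {s₁ : ℝ} (hs₁ : 0 < s₁) (s₂ : ℝ) {h x : ℝ} (hx : x ≠ s₂) (hh : h ≤ s₁) :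
    Tendsto (fun n : ℕ => if (size s₁ s₂ n : ℝ) ≤ h * n + x * √(n : ℝ) then (1 : ℝ) else 0) atTop
      (𝓝 (if s₁ ≤ h then normalCdf 0 (x - s₂) else 0)) := by
  have hsize := tendsto_size_sub hs₁ s₂
  have key : ∀ n : ℕ, 1 ≤ n → ((size s₁ s₂ n : ℝ) ≤ h * n + x * √(n : ℝ) ↔
      ((size s₁ s₂ n : ℝ) - s₁ * n) / √(n : ℝ) + (s₁ - h) * √(n : ℝ) ≤ x) := by
    intro n hn
    have hn' : 0 < √(n : ℝ) := Real.sqrt_pos.2 (by exact_mod_cast hn)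
    have h1 : (s₁ - h) * √(n : ℝ) = (s₁ - h) * n / √(n : ℝ) := by
      rw [eq_div_iff hn'.ne', mul_assoc, Real.mul_self_sqrt (Nat.cast_nonneg n)]
    rw [h1, ← add_div, div_le_iff₀ hn']
    constructor <;> intro h <;> linarith
  split_ifs with h1
  · obtain rfl := le_antisymm hh h1
    rw [normalCdf_zero]
    refine tendsto_const_nhds.congr' ?_
    rcases lt_or_gt_of_ne hx with h2 | h2
    · filter_upwards [hsize.eventually (lt_mem_nhds h2), eventually_ge_atTop 1] with n hn hn1
      rw [if_neg (by linarith), if_neg]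
      rw [key n hn1]
      simpa using hn
    · filter_upwards [hsize.eventually (gt_mem_nhds h2), eventually_ge_atTop 1] with n hn hn1
      rw [if_pos (by linarith), if_pos]
      rw [key n hn1]
      simpa using hn.le
  · refine tendsto_const_nhds.congr' ?_
    have h2 : Tendsto (fun n : ℕ => ((size s₁ s₂ n : ℝ) - s₁ * n) / √(n : ℝ) +
        (s₁ - h) * √(n : ℝ)) atTop atTop :=
      hsize.add_atTop (tendsto_sqrt_natCast_atTop.const_mul_atTop (sub_pos.2 (not_le.1 h1)))
    filter_upwards [h2.eventually (eventually_gt_atTop x), eventually_ge_atTop 1] with n hn hn1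
    rw [if_neg]
    rw [key n hn1]
    exact not_le.2 hn

theorem profile_mono {P : X → ℝ} (hP : ∀ x, 0 ≤ P x) (N : ℕ) : Monotone (profile P N) := by
  intro r r' h
  refine max_le_max (levelMass_mono hP h) ?_
  split_ifs <;> linarith

theorem shiftTendsto_profile {P : X → ℝ} (hP : P ∈ stdSimplex ℝ X) {s₁ : ℝ} (hs₁ : 0 < s₁)
    (s₂ : ℝ) :
    ShiftTendsto (fun n x => profile (iid P n) (size s₁ s₂ n)
      (min (shannonEntropy P) s₁ * n + x * √(n : ℝ))) (limitProfile P s₁ s₂) := by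
  have hmono : ∀ n : ℕ, Monotone fun x => profile (iid P n) (size s₁ s₂ n)
      (min (shannonEntropy P) s₁ * n + x * √(n : ℝ)) := fun n x x' h =>
    profile_mono (iid_mem_stdSimplex hP n).1 _ (by gcongr)
  refine shiftTendsto_of_tendsto hmono (isProfile_limitProfile hP s₁ s₂).mono 0 s₂
    fun x hx hx' => ?_
  have h1 := tendsto_source hP hx (min_le_left (shannonEntropy P) s₁)
  have h2 := tendsto_storage hs₁ s₂ hx' (min_le_right (shannonEntropy P) s₁)
  have e1 : (if shannonEntropy P ≤ min (shannonEntropy P) s₁ then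
      normalCdf (varentropy P) (x - 0) else 0) =
      if shannonEntropy P ≤ s₁ then normalCdf (varentropy P) (x - 0) else 0 :=
    if_congr (by simp) rfl rfl
  have e2 : (if s₁ ≤ min (shannonEntropy P) s₁ then normalCdf 0 (x - s₂) else 0) =
      if s₁ ≤ shannonEntropy P then normalCdf 0 (x - s₂) else 0 := if_congr (by simp) rfl rfl
  rw [e1] at h1
  rw [e2] at h2
  exact h1.max h2

/-! ### Limits for the target -/

/-- The shift `shannonEntropy Q * t` is the entropy of the `t * √n` extra copies, and `√t₁` enters
because the fluctuations scale with the square root of the number of copies. -/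
theorem tendsto_levelMass_target {Q : Y → ℝ} (hQ : Q ∈ stdSimplex ℝ Y) {t₁ : ℝ} (ht₁ : 0 < t₁)
    (t : ℝ) {c : ℝ} (hc : 0 < varentropy Q ∨ c ≠ 0) {r : ℕ → ℝ}
    (hr : Tendsto (fun n : ℕ => (r n - t₁ * shannonEntropy Q * n) / √(n : ℝ)) atTop
      (𝓝 (shannonEntropy Q * t + c))) :
    Tendsto (fun n => levelMass (iid Q (size t₁ t n)) (r n)) atTop
      (𝓝 (normalCdf (varentropy Q) (c / √t₁))) := by
  have hst : 0 < √t₁ := Real.sqrt_pos.2 ht₁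
  refine tendsto_levelMass_iid hQ (tendsto_size_atTop ht₁ t)
    (hc.imp_right fun h => div_ne_zero h hst.ne') ?_
  have h1 := hr.sub ((tendsto_size_sub ht₁ t).mul_const (shannonEntropy Q))
  have h2 := (Real.continuous_sqrt.tendsto t₁).comp (tendsto_size_div ht₁ t)
  have h3 := h1.div h2 hst.ne'
  have h4 : shannonEntropy Q * t + c - t * shannonEntropy Q = c := by ring
  rw [h4] at h3
  refine h3.congr' ?_
  filter_upwards [eventually_ge_atTop 1] with n hn
  have hn' : 0 < √(n : ℝ) := Real.sqrt_pos.2 (by exact_mod_cast hn)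
  simp only [Function.comp, Pi.div_apply]
  rw [Real.sqrt_div (Nat.cast_nonneg _), div_mul_eq_mul_div, ← sub_div, div_div_div_cancel_right₀ hn'.ne']
  congr 1
  ring

theorem tendsto_topSum_target {Q : Y → ℝ} (hQ : Q ∈ stdSimplex ℝ Y) {t₁ : ℝ} (ht₁ : 0 < t₁)
    (t : ℝ) {c : ℝ} (hc : 0 < varentropy Q ∨ c ≠ 0) {r : ℕ → ℝ}
    (hr : Tendsto (fun n : ℕ => (r n - t₁ * shannonEntropy Q * n) / √(n : ℝ)) atTop
      (𝓝 (shannonEntropy Q * t + c))) :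
    Tendsto (fun n => topSum (iid Q (size t₁ t n)) ⌊(2 : ℝ) ^ r n⌋₊) atTop
      (𝓝 (normalCdf (varentropy Q) (c / √t₁))) := by
  have h1 := tendsto_levelMass_target hQ ht₁ t hc hr
  have h2 := tendsto_levelMass_target hQ ht₁ t hc (r := fun n => r n + √(√(n : ℝ))) (by
    have := hr.add tendsto_sqrt_sqrt_div
    rw [add_zero] at this
    refine this.congr fun n => ?_
    rw [← add_div]
    congr 1
    ring)
  have h3 : Tendsto (fun n : ℕ => (2 : ℝ) ^ (-√(√(n : ℝ)))) atTop (𝓝 0) :=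
    (tendsto_rpow_atBot_of_base_gt_one 2 one_lt_two).comp (tendsto_neg_atTop_atBot.comp
      (Real.tendsto_sqrt_atTop.comp tendsto_sqrt_natCast_atTop))
  have h4 := h2.add h3
  rw [add_zero] at h4
  exact tendsto_of_tendsto_of_tendsto_of_le_of_le h1 h4
    (fun n => levelMass_le_topSum (iid_mem_stdSimplex hQ _) _)
    (fun n => topSum_le_levelMass_add (iid_mem_stdSimplex hQ _) _ _)

end Asymptotic

/-! ### Asymptotic converse and achievability. -/

section Bounds

/-- Contribution of the inner bins to the fidelity of two distributions with the cumulative values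
`A` and `T` at the boundaries of the bins. -/
noncomputable def binSum (A T : ℕ → ℝ) (m : ℕ) : ℝ :=
  ∑ j ∈ Finset.range m, √((A (j + 1) - A j) * (T (j + 1) - T j))

/-- Asymptotic upper bound: if the accuracies `F t n` for the target shifted by `H * t` do not stay
below `u`, then so does the fidelity of the target with a distribution function that dominates
the profile `S`. -/
def Converse (F : ℝ → ℕ → ℝ) (S T : ℝ → ℝ) (H v : ℝ) : Prop :=
  ∀ (t u : ℝ) (c : ℕ → ℝ) (m : ℕ), Monotone c → (∀ j, 0 < v ∨ c j ≠ 0) →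
    (∀ u' < u, ∃ᶠ n in atTop, u' ≤ F t n) →
    ∃ A : ℕ → ℝ, Monotone A ∧ (∀ j, A j ∈ Set.Icc (0 : ℝ) 1) ∧
      (∀ j x, x < H * t + c j → S x ≤ A j) ∧
      u ≤ √(A 0 * T (c 0)) + binSum A (fun j => T (c j)) m + √((1 - A m) * (1 - T (c m)))

/-- Asymptotic lower bound: every distribution function that dominates the profile `S` can be
achieved. -/
def Achievable (F : ℝ → ℕ → ℝ) (S T : ℝ → ℝ) (H v : ℝ) : Prop :=
  ∀ (t : ℝ) (c : ℕ → ℝ) (m : ℕ) (A : ℕ → ℝ), Monotone c → (∀ j, 0 < v ∨ c j ≠ 0) →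
    Monotone A → (∀ j, A j ∈ Set.Icc (0 : ℝ) 1) →
    (∀ j < m, A j < A (j + 1) → ∃ x, H * t + c (j + 1) < x ∧ S x ≤ A j) →
    ∀ w < binSum A (fun j => T (c j)) m, ∀ᶠ n in atTop, w ≤ F t n

variable {X Y : Type*} [Fintype X] [Fintype Y]

/-- Nearly optimal conversions at arbitrarily large `n` give cumulative values in the compact cube
`[0,1]^ℕ`; a limit point satisfies all the inequalities. -/
theorem converse_maxFidelityM {P : X → ℝ} (hP : P ∈ stdSimplex ℝ X) {Q : Y → ℝ}
    (hQ : Q ∈ stdSimplex ℝ Y) {s₁ t₁ : ℝ} (hs₁ : 0 < s₁) (s₂ : ℝ) (ht₁ : 0 < t₁)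
    (h : t₁ * shannonEntropy Q = min (shannonEntropy P) s₁) :
    Converse (fun t n => maxFidelityM (iid P n) (iid Q (size t₁ t n)) (size s₁ s₂ n))
      (limitProfile P s₁ s₂) (fun c => normalCdf (varentropy Q) (c / √t₁))
      (shannonEntropy Q) (varentropy Q) := by
  intro t u c m hc hgood hF
  set ρ : ℕ → ℕ → ℝ := fun n j =>
    min (shannonEntropy P) s₁ * n + (shannonEntropy Q * t + c j) * √(n : ℝ) with hρ
  have hρm : ∀ n, Monotone (ρ n) := fun n i j hij => by
    have := hc hij
    simp only [hρ]
    gcongr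
  let τ : ℕ → ℕ → ℝ := fun n j => topSum (iid Q (size t₁ t n)) ⌊(2 : ℝ) ^ ρ n j⌋₊
  have hτ : ∀ j, Tendsto (fun n => τ n j) atTop
      (𝓝 (normalCdf (varentropy Q) (c j / √t₁))) := by
    intro j
    refine tendsto_topSum_target hQ ht₁ t (hgood j) (r := fun n => ρ n j)
      (tendsto_const_nhds.congr' ?_)
    filter_upwards [eventually_ge_atTop 1] with n hn
    have hn' : 0 < √(n : ℝ) := Real.sqrt_pos.2 (by exact_mod_cast hn)
    rw [eq_div_iff hn'.ne', h]
    simp only [hρ]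
    ring
  have hstep : ∀ k : ℕ, ∃ n ≥ k, ∃ A : ℕ → ℝ, Monotone A ∧ (∀ j, A j ∈ Set.Icc (0 : ℝ) 1) ∧
      (∀ j, profile (iid P n) (size s₁ s₂ n) (ρ n j) ≤ A j) ∧
      u - 1 / ((k : ℝ) + 1) ≤ √(A 0 * τ n 0) + binSum A (τ n) m +
        √((1 - A m) * (1 - τ n m)) := by
    intro k
    have hpos : (0 : ℝ) < 1 / ((k : ℝ) + 1) := by positivity
    -- Half of the margin is spent here; the other half is for a supremum that need not be attained.
    obtain ⟨n, hn, hFn⟩ := (frequently_atTop.1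
      (hF (u - 1 / ((k : ℝ) + 1) / 2) (by linarith))) k
    have hne : (fidelitiesM (iid P n) (iid Q (size t₁ t n)) (size s₁ s₂ n)).Nonempty :=
      (fidelitiesD_nonempty _ (iid_mem_stdSimplex hQ _) _).mono
        (fidelitiesD_subset_fidelitiesM (iid_mem_stdSimplex hP n) _ _)
    obtain ⟨r, hr, hlt⟩ := exists_lt_of_lt_csSup hne
      (show u - 1 / ((k : ℝ) + 1) < sSup _ from lt_of_lt_of_le (by linarith) hFn)
    obtain ⟨A, hA1, hA2, hA3, hA4⟩ := exists_le_of_mem_fidelitiesM (iid_mem_stdSimplex hP n)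
      (iid_mem_stdSimplex hQ _) hr (hρm n) m
    exact ⟨n, hn, A, hA1, hA2, hA3, hlt.le.trans hA4⟩
  choose n hn A hA1 hA2 hA3 hA4 using hstep
  have hcompact : IsCompact (Set.pi Set.univ fun _ : ℕ => Set.Icc (0 : ℝ) 1) :=
    isCompact_univ_pi fun _ => isCompact_Icc
  obtain ⟨B, -, φ, hφ, hlim⟩ := hcompact.tendsto_subseq (x := A) fun k j _ => hA2 k j
  have hlim' : ∀ j, Tendsto (fun k => A (φ k) j) atTop (𝓝 (B j)) := fun j =>
    (tendsto_pi_nhds.1 hlim) j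
  have hnφ : Tendsto (fun k => n (φ k)) atTop atTop :=
    tendsto_atTop_mono (fun k => hn (φ k)) hφ.tendsto_atTop
  have hτ' : ∀ j, Tendsto (fun k => τ (n (φ k)) j) atTop
      (𝓝 (normalCdf (varentropy Q) (c j / √t₁))) := fun j => (hτ j).comp hnφ
  refine ⟨B, fun i j hij => le_of_tendsto_of_tendsto' (hlim' i) (hlim' j) fun k => hA1 _ hij,
    fun j => ⟨ge_of_tendsto' (hlim' j) fun k => (hA2 _ j).1,
      le_of_tendsto' (hlim' j) fun k => (hA2 _ j).2⟩, fun j x hx => ?_, ?_⟩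
  · refine le_of_forall_lt fun d hd => ?_
    obtain ⟨d', hd1, hd2⟩ := exists_between hd
    refine hd1.trans_le (ge_of_tendsto (hlim' j) ?_)
    have h1 := (shiftTendsto_profile hP hs₁ s₂ hx).1 d' hd2
    filter_upwards [hnφ.eventually h1] with k hk
    exact hk.trans (hA3 _ j)
  · have hsqrt : ∀ {f : ℕ → ℝ} {a : ℝ}, Tendsto f atTop (𝓝 a) →
        Tendsto (fun k => √(f k)) atTop (𝓝 √a) := fun hf =>
      (Real.continuous_sqrt.tendsto _).comp hf
    have h1 := hsqrt ((hlim' 0).mul (hτ' 0))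
    have h2 := hsqrt (((hlim' m).const_sub 1).mul ((hτ' m).const_sub 1))
    have h3 : Tendsto (fun k => binSum (A (φ k)) (τ (n (φ k))) m) atTop
        (𝓝 (binSum B (fun j => normalCdf (varentropy Q) (c j / √t₁)) m)) :=
      tendsto_finsetSum _ fun j _ => hsqrt
        (((hlim' (j + 1)).sub (hlim' j)).mul ((hτ' (j + 1)).sub (hτ' j)))
    have h4 : Tendsto (fun k => u - 1 / ((φ k : ℝ) + 1)) atTop (𝓝 u) := by
      simpa using (tendsto_one_div_add_atTop_nhds_zero_nat.comp hφ.tendsto_atTop).const_sub u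
    exact le_of_tendsto_of_tendsto' h4 ((h1.add h3).add h2) fun k => hA4 _

theorem achievable_maxFidelityD {P : X → ℝ} (hP : P ∈ stdSimplex ℝ X) {Q : Y → ℝ}
    (hQ : Q ∈ stdSimplex ℝ Y) {s₁ t₁ : ℝ} (hs₁ : 0 < s₁) (s₂ : ℝ) (ht₁ : 0 < t₁)
    (h : t₁ * shannonEntropy Q = min (shannonEntropy P) s₁) :
    Achievable (fun t n => maxFidelityD (iid P n) (iid Q (size t₁ t n)) (size s₁ s₂ n))
      (limitProfile P s₁ s₂) (fun c => normalCdf (varentropy Q) (c / √t₁))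
      (shannonEntropy Q) (varentropy Q) := by
  intro t c m A hc hgood hA hA01 hdom w hw
  set ρ : ℕ → ℕ → ℝ := fun n j =>
    min (shannonEntropy P) s₁ * n + (shannonEntropy Q * t + c j) * √(n : ℝ) with hρ
  have hρm : ∀ n, Monotone (ρ n) := fun n i j hij => by
    have := hc hij
    simp only [hρ]
    gcongr
  let T : ℕ → ℝ := fun j => normalCdf (varentropy Q) (c j / √t₁)
  let τ : ℕ → ℕ → ℝ := fun n j => levelMass (iid Q (size t₁ t n)) (ρ n j)
  have hτ : ∀ j, Tendsto (fun n => τ n j) atTop (𝓝 (T j)) := by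
    intro j
    refine tendsto_levelMass_target hQ ht₁ t (hgood j) (r := fun n => ρ n j)
      (tendsto_const_nhds.congr' ?_)
    filter_upwards [eventually_ge_atTop 1] with n hn
    have hn' : 0 < √(n : ℝ) := Real.sqrt_pos.2 (by exact_mod_cast hn)
    rw [eq_div_iff hn'.ne', h]
    simp only [hρ]
    ring
  obtain ⟨ζ, hζ0, hζ1, hζw⟩ : ∃ ζ : ℝ, 0 < ζ ∧ ζ < 1 ∧
      w < √(1 - ζ) * (√(1 - ζ) * binSum A T m) := by
    have h1 : Tendsto (fun ζ : ℝ => √(1 - ζ) * (√(1 - ζ) * binSum A T m)) (𝓝[>] 0)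
        (𝓝 (√(1 - 0) * (√(1 - 0) * binSum A T m))) := by
      refine Tendsto.mono_left (Continuous.tendsto ?_ 0) nhdsWithin_le_nhds
      fun_prop
    simp only [sub_zero, Real.sqrt_one, one_mul] at h1
    have h2 : ∀ᶠ ζ : ℝ in 𝓝[>] 0, ζ ∈ Set.Ioo (0 : ℝ) 1 := Ioo_mem_nhdsGT zero_lt_one
    obtain ⟨ζ, h3, h4⟩ := ((h1.eventually (lt_mem_nhds hw)).and h2).exists
    exact ⟨ζ, h4.1, h4.2, h3⟩
  -- Mixing `A` with `1` makes `S x ≤ A j` strict, as `A j < 1` wherever `A` increases, so the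
  -- profiles at finite `n` also fit below `B j`. The cost is one factor `√(1 - ζ)`; the other comes
  -- from using `ζ` as the tolerance `η`.
  let B : ℕ → ℝ := fun j => (1 - ζ) * A j + ζ
  have hBsub : ∀ j, B (j + 1) - B j = (1 - ζ) * (A (j + 1) - A j) := fun j => by
    simp only [B]; ring
  have hBm : Monotone B := fun i j hij => by
    have := hA hij
    have h1 : 0 ≤ 1 - ζ := by linarith
    simp only [B]
    gcongr
  have hev : ∀ j ∈ Finset.range m, ∀ᶠ n in atTop, B j < B (j + 1) →
      profile (iid P n) (size s₁ s₂ n) (ρ n (j + 1) + √(√(n : ℝ))) ≤ B j ∧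
        (2 : ℝ) ^ (-√(√(n : ℝ))) ≤ ζ * (B (j + 1) - B j) := by
    intro j hj
    by_cases hlt : B j < B (j + 1)
    · have hlt' : A j < A (j + 1) := by
        have h1 := sub_pos.2 hlt
        rw [hBsub] at h1
        exact sub_pos.1 (pos_of_mul_pos_right h1 (by linarith))
      obtain ⟨x, hx, hSx⟩ := hdom j (Finset.mem_range.1 hj) hlt'
      obtain ⟨x', hx', hx''⟩ := exists_between hx
      have hSB : limitProfile P s₁ s₂ x < B j := by
        have h1 : A j < 1 := hlt'.trans_le (hA01 _).2
        have h2 : A j < B j := by simp only [B]; nlinarith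
        linarith
      have h1 := (shiftTendsto_profile hP hs₁ s₂ hx'').2 (B j) hSB
      have h2 : Tendsto (fun n : ℕ => shannonEntropy Q * t + c (j + 1) + √(√(n : ℝ)) / √(n : ℝ))
          atTop (𝓝 (shannonEntropy Q * t + c (j + 1))) := by
        simpa using tendsto_sqrt_sqrt_div.const_add (shannonEntropy Q * t + c (j + 1))
      have h3 : Tendsto (fun n : ℕ => (2 : ℝ) ^ (-√(√(n : ℝ)))) atTop (𝓝 0) :=
        (tendsto_rpow_atBot_of_base_gt_one 2 one_lt_two).comp (tendsto_neg_atTop_atBot.comp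
          (Real.tendsto_sqrt_atTop.comp tendsto_sqrt_natCast_atTop))
      filter_upwards [h1, h2.eventually (gt_mem_nhds hx'),
        h3.eventually (gt_mem_nhds (mul_pos hζ0 (sub_pos.2 hlt))), eventually_ge_atTop 1]
        with n hn1 hn2 hn3 hn4 _
      refine ⟨(profile_mono (iid_mem_stdSimplex hP n).1 _ ?_).trans hn1, hn3.le⟩
      have hn' : 0 < √(n : ℝ) := Real.sqrt_pos.2 (by exact_mod_cast hn4)
      have h4 := mul_le_mul_of_nonneg_right hn2.le hn'.le
      rw [add_mul _ (_ / _), div_mul_cancel₀ _ hn'.ne'] at h4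
      simp only [hρ]
      linarith
    · exact Eventually.of_forall fun n h => absurd h hlt
  have hev' := (Finset.eventually_all (Finset.range m)).2 hev
  have hsqrt : ∀ {f : ℕ → ℝ} {a : ℝ}, Tendsto f atTop (𝓝 a) →
      Tendsto (fun k => √(f k)) atTop (𝓝 √a) := fun hf =>
    (Real.continuous_sqrt.tendsto _).comp hf
  have h3 : Tendsto (fun n => √(1 - ζ) * ∑ j ∈ Finset.range m,
      √((B (j + 1) - B j) * (τ n (j + 1) - τ n j))) atTop
      (𝓝 (√(1 - ζ) * (√(1 - ζ) * binSum A T m))) := by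
    have h4 : √(1 - ζ) * binSum A T m =
        ∑ j ∈ Finset.range m, √((B (j + 1) - B j) * (T (j + 1) - T j)) := by
      rw [binSum, Finset.mul_sum]
      refine Finset.sum_congr rfl fun j _ => ?_
      rw [hBsub, mul_assoc (1 - ζ), Real.sqrt_mul (sub_nonneg.2 hζ1.le)]
    rw [h4]
    exact (tendsto_finsetSum _ fun j _ => hsqrt
      (((hτ (j + 1)).sub (hτ j)).const_mul _)).const_mul _
  filter_upwards [hev', h3.eventually (lt_mem_nhds hζw)] with n hn1 hn2
  refine hn2.le.trans (le_maxFidelityD_of_profile_le (iid_mem_stdSimplex hP n)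
    (iid_mem_stdSimplex hQ _) (hρm n) hBm ?_ ?_ hζ0 hζ1 (Real.sqrt_nonneg _)
    fun j hj hlt => hn1 j (Finset.mem_range.2 hj) hlt)
  · have := (hA01 0).1
    simp only [B]
    nlinarith
  · intro j
    have := (hA01 j).2
    simp only [B]
    nlinarith

end Bounds

/-! ### Strict decrease, extreme values and continuity of the accuracy. -/

section Gap

/-- Each term is the square root of an affine function of the cumulative values. -/
theorem binSum_concave {A B T : ℕ → ℝ} (hA : Monotone A) (hB : Monotone B) (hT : Monotone T)
    {θ : ℝ} (h0 : 0 ≤ θ) (h1 : θ ≤ 1) (m : ℕ) :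
    (1 - θ) * binSum A T m + θ * binSum B T m ≤
      binSum (fun j => (1 - θ) * A j + θ * B j) T m := by
  simp only [binSum, Finset.mul_sum]
  rw [← Finset.sum_add_distrib]
  refine Finset.sum_le_sum fun j _ => ?_
  have hA' := sub_nonneg.2 (hA (Nat.le_succ j))
  have hB' := sub_nonneg.2 (hB (Nat.le_succ j))
  have hT' := sub_nonneg.2 (hT (Nat.le_succ j))
  have h2 := Real.strictConcaveOn_sqrt.concaveOn.2 (mul_nonneg hA' hT') (mul_nonneg hB' hT')
    (sub_nonneg.2 h1) h0 (by ring)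
  simp only [smul_eq_mul] at h2
  refine h2.trans (le_of_eq ?_)
  congr 1
  simp only [Nat.succ_eq_add_one]
  ring

theorem exists_pos_le {ι : Type*} (s : Finset ι) (f : ι → ℝ) :
    ∃ θ > 0, ∀ k ∈ s, 0 < f k → θ ≤ f k := by
  classical
  induction s using Finset.induction with
  | empty => exact ⟨1, one_pos, by simp⟩
  | insert a s _ ih =>
    obtain ⟨θ, hθ, h⟩ := ih
    by_cases ha : 0 < f a
    · refine ⟨min θ (f a), lt_min hθ ha, fun k hk hk0 => ?_⟩
      rcases Finset.mem_insert.1 hk with rfl | hk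
      · exact min_le_right _ _
      · exact (min_le_left _ _).trans (h k hk hk0)
    · refine ⟨θ, hθ, fun k hk hk0 => ?_⟩
      rcases Finset.mem_insert.1 hk with rfl | hk
      · exact absurd hk0 ha
      · exact h k hk hk0

variable {FD FM : ℝ → ℕ → ℝ} {S T : ℝ → ℝ} {H v : ℝ}

/-- Where the profile has reached `1`, all output mass lies before the boundary `c`, and the target
has only `T c` there. -/
theorem Converse.le_sqrt (hC : Converse FM S T H v) {t u c : ℝ} (hc : c ≠ 0)
    (h : ∀ u' < u, ∃ᶠ n in atTop, u' ≤ FM t n) {x : ℝ} (hx : x < H * t + c) (hSx : 1 ≤ S x) :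
    u ≤ √(T c) := by
  obtain ⟨A, -, hA2, hA3, hA4⟩ := hC t u (fun _ => c) 0 monotone_const (fun _ => Or.inr hc) h
  have h1 : A 0 = 1 := le_antisymm (hA2 0).2 (hSx.trans (hA3 0 x hx))
  simpa [binSum, h1] using hA4

theorem tendsto_grid_atTop {δ : ℝ} (hδ : 0 < δ) :
    Tendsto (fun k : ℤ => ((k : ℝ) + 1 / 2) * δ) atTop atTop :=
  (tendsto_atTop_add_const_right _ _ tendsto_intCast_atTop_atTop).atTop_mul_const hδ

theorem tendsto_grid_atBot {δ : ℝ} (hδ : 0 < δ) :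
    Tendsto (fun k : ℤ => ((k : ℝ) + 1 / 2) * δ) atBot atBot :=
  (tendsto_atBot_add_const_right _ _
    (tendsto_intCast_atBot_iff.2 tendsto_id)).atBot_mul_const hδ

/-- Half-integer multiples avoid `0`, where `T` may jump. -/
theorem grid_ne_zero {δ : ℝ} (hδ : 0 < δ) (k : ℤ) : ((k : ℝ) + 1 / 2) * δ ≠ 0 := by
  refine mul_ne_zero (fun h => ?_) hδ.ne'
  have h1 : (2 * k + 1 : ℤ) = 0 := by
    have : (2 * (k : ℝ) + 1) = 0 := by linarith
    exact_mod_cast this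
  omega

/-- If `S` never reaches `1`, any far boundary serves. Otherwise take the last boundary where `S`,
shifted by `2 * δ`, is below `1`. Saturation at the next one gives `u ^ 2 ≤ T` by
`Converse.le_sqrt`; one more grid step makes this strict and raises the shift to `3 * δ`. -/
theorem exists_grid_point (hC : Converse FM S T H v) (hS : IsProfile S)
    (hS0 : Tendsto S atBot (𝓝 0)) (hT : IsProfile T) (hT1 : Tendsto T atTop (𝓝 1))
    {t u δ : ℝ} (hδ : 0 < δ) (hu0 : 0 < u) (hu1 : u < 1)
    (h : ∀ u' < u, ∃ᶠ n in atTop, u' ≤ FM t n) :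
    ∃ k : ℤ, S (H * t + ((k : ℝ) + 1 / 2) * δ - 3 * δ) < 1 ∧ u ^ 2 < T (((k : ℝ) + 1 / 2) * δ) := by
  have hu2 : u ^ 2 < 1 := by nlinarith
  by_cases hall : ∀ x, S x < 1
  · obtain ⟨k, hk⟩ := ((hT1.comp (tendsto_grid_atTop hδ)).eventually (lt_mem_nhds hu2)).exists
    exact ⟨k, hall _, hk⟩
  · push Not at hall
    obtain ⟨x₀, hx₀⟩ := hall
    have hbdd : ∃ b : ℤ, ∀ z : ℤ, S (H * t + ((z : ℝ) + 1 / 2) * δ - 2 * δ) < 1 → z ≤ b := by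
      obtain ⟨b, hb⟩ := ((tendsto_grid_atTop hδ).eventually
        (eventually_ge_atTop (x₀ - H * t + 2 * δ))).exists
      refine ⟨b, fun z hz => ?_⟩
      by_contra hbz
      have h1 : (b : ℝ) ≤ z := by exact_mod_cast (not_le.1 hbz).le
      have h2 : ((b : ℝ) + 1 / 2) * δ ≤ ((z : ℝ) + 1 / 2) * δ := by gcongr
      have h3 := hS.mono (show x₀ ≤ H * t + ((z : ℝ) + 1 / 2) * δ - 2 * δ by linarith)
      linarith
    have hne : ∃ z : ℤ, S (H * t + ((z : ℝ) + 1 / 2) * δ - 2 * δ) < 1 := by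
      have h1 : Tendsto (fun z : ℤ => H * t + ((z : ℝ) + 1 / 2) * δ - 2 * δ) atBot atBot :=
        tendsto_atBot_add_const_right _ _
          (tendsto_atBot_add_const_left _ _ (tendsto_grid_atBot hδ))
      exact ((hS0.comp h1).eventually (gt_mem_nhds one_pos)).exists
    obtain ⟨k, hk, hmax⟩ := Int.exists_greatest_of_bdd hbdd hne
    have h1 : ¬ S (H * t + (((k + 1 : ℤ) : ℝ) + 1 / 2) * δ - 2 * δ) < 1 := fun h2 => by
      have := hmax _ h2
      omega
    push_cast at h1
    have h2 : u ≤ √(T (((k : ℝ) + 1 / 2) * δ)) := by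
      refine hC.le_sqrt (grid_ne_zero hδ k) h
        (x := H * t + ((k : ℝ) + 1 + 1 / 2) * δ - 2 * δ) ?_ (not_lt.1 h1)
      linarith
    have h3 : u ^ 2 ≤ T (((k : ℝ) + 1 / 2) * δ) := by
      have := pow_le_pow_left₀ hu0.le h2 2
      rwa [Real.sq_sqrt (hT.nonneg _)] at this
    refine ⟨k + 1, ?_, ?_⟩
    · push_cast
      convert hk using 2
      ring
    · push_cast
      have h4 : ((k : ℝ) + 1 / 2) * δ < ((k : ℝ) + 1 + 1 / 2) * δ := by gcongr; linarith
      rcases (hT.le_one (((k : ℝ) + 1 / 2) * δ)).eq_or_lt with h5 | h5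
      · have := hT.mono h4.le
        linarith
      · have h6 : 0 < T (((k : ℝ) + 1 + 1 / 2) * δ) :=
          lt_of_lt_of_le (by positivity) (h3.trans (hT.mono h4.le))
        exact h3.trans_lt (hT.lt h4 h5 h6)

/-- A larger target is strictly less accurate: if the accuracies of majorization conversion do not
stay below `u`, then deterministic conversion to a smaller target is eventually more accurate. -/
theorem exists_eventually_le_of_frequently_le (hH : 0 < H) (hC : Converse FM S T H v)
    (hD : Achievable FD S T H v) (hS : IsProfile S) (hS0 : Tendsto S atBot (𝓝 0))
    (hT : IsProfile T) (hT0 : Tendsto T atBot (𝓝 0)) (hT1 : Tendsto T atTop (𝓝 1))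
    {t t' u : ℝ} (ht : t' < t) (hu0 : 0 < u) (hu1 : u < 1)
    (h : ∀ u' < u, ∃ᶠ n in atTop, u' ≤ FM t n) :
    ∃ w > u, ∀ᶠ n in atTop, w ≤ FD t' n := by
  -- Budget for the change of target: `A` dominates `S` shifted by `2 * δ`, the mixture only has to
  -- dominate it shifted by `3 * δ`, one `δ` is the bin width, and the last makes the inequality in
  -- `Achievable` strict.
  obtain ⟨δ, hδ, hδt⟩ : ∃ δ > 0, H * t' = H * t - 5 * δ :=
    ⟨H * (t - t') / 5, by have := sub_pos.2 ht; positivity, by ring⟩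
  let g : ℤ → ℝ := fun k => ((k : ℝ) + 1 / 2) * δ
  have hg : Monotone g := fun k k' hk => by
    have : (k : ℝ) ≤ k' := by exact_mod_cast hk
    simp only [g]
    gcongr
  have hg1 : ∀ k, g (k + 1) = g k + δ := fun k => by
    simp only [g]; push_cast; ring
  obtain ⟨J, hJS, hJT⟩ := exists_grid_point hC hS hS0 hT hT1 hδ hu0 hu1 h
  change S (H * t + g J - 3 * δ) < 1 at hJS
  change u ^ 2 < T (g J) at hJT
  set a := T (g J) with ha
  have ha0 : 0 < a := lt_of_le_of_lt (sq_nonneg u) hJT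
  have hua : u < √a := Real.lt_sqrt_of_sq_lt hJT
  obtain ⟨ζ, hζ0, hζ1, hζu⟩ : ∃ ζ : ℝ, 0 < ζ ∧ ζ < 1 ∧ u < √(1 - ζ) * √a := by
    have h1 : Tendsto (fun ζ : ℝ => √(1 - ζ) * √a) (𝓝[>] 0) (𝓝 (√(1 - 0) * √a)) := by
      refine Tendsto.mono_left (Continuous.tendsto ?_ 0) nhdsWithin_le_nhds
      fun_prop
    simp only [sub_zero, Real.sqrt_one, one_mul] at h1
    have h2 : ∀ᶠ ζ : ℝ in 𝓝[>] 0, ζ ∈ Set.Ioo (0 : ℝ) 1 := Ioo_mem_nhdsGT zero_lt_one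
    obtain ⟨ζ, h3, h4⟩ := ((h1.eventually (lt_mem_nhds hua)).and h2).exists
    exact ⟨ζ, h4.1, h4.2, h3⟩
  obtain ⟨k₀, hk₀⟩ : ∃ k₀ : ℤ, S (H * t + g k₀) < ζ := by
    have h1 : Tendsto (fun z : ℤ => H * t + g z) atBot atBot :=
      tendsto_atBot_add_const_left _ _ (tendsto_grid_atBot hδ)
    exact ((hS0.comp h1).eventually (gt_mem_nhds hζ0)).exists
  -- Room gained by the extra shift `δ`: the increments of `S`, where positive, are bounded below
  -- over finitely many boundaries.
  obtain ⟨θ₀, hθ₀, hθ₀'⟩ := exists_pos_le (Finset.Icc k₀ J)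
    fun k => S (H * t + g k - 2 * δ) - S (H * t + g k - 3 * δ)
  obtain ⟨θ, hθ0, hθ1, hθ⟩ : ∃ θ : ℝ, 0 < θ ∧ θ < 1 ∧ ∀ k ∈ Finset.Icc k₀ J,
      0 < S (H * t + g k - 2 * δ) - S (H * t + g k - 3 * δ) →
      θ ≤ S (H * t + g k - 2 * δ) - S (H * t + g k - 3 * δ) :=
    ⟨min θ₀ (1 / 2), lt_min hθ₀ (by norm_num), (min_le_right _ _).trans_lt (by norm_num),
      fun k hk hk' => (min_le_left _ _).trans (hθ₀' k hk hk')⟩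
  -- If `S` at shift `2 * δ` is at most `ζ`, it is below both `α` and `β`. Otherwise the extra shift
  -- lowers `S` by at least `θ`, whereas mixing lowers `α` by at most `θ`.
  have hdom : ∀ k ≤ J, ∀ α β : ℝ, 0 ≤ α → α ≤ 1 → ζ ≤ β → S (H * t + g k - 2 * δ) ≤ α →
      S (H * t + g k - 3 * δ) ≤ (1 - θ) * α + θ * β := by
    intro k hk α β hα0 hα1 hβ hSα
    have h1 : S (H * t + g k - 3 * δ) ≤ S (H * t + g k - 2 * δ) := hS.mono (by linarith)
    by_cases h2 : S (H * t + g k - 2 * δ) ≤ ζ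
    · have h3 : (1 - θ) * S (H * t + g k - 2 * δ) ≤ (1 - θ) * α :=
        mul_le_mul_of_nonneg_left hSα (by linarith)
      have h4 : θ * S (H * t + g k - 2 * δ) ≤ θ * β :=
        mul_le_mul_of_nonneg_left (h2.trans hβ) hθ0.le
      linarith
    · push Not at h2
      have h3 : k₀ ≤ k := by
        by_contra h4
        have h5 := hS.mono (show H * t + g k - 2 * δ ≤ H * t + g k₀ by
          have := hg (not_le.1 h4).le
          linarith)
        linarith
      have h4 : S (H * t + g k - 3 * δ) < 1 :=
        lt_of_le_of_lt (hS.mono (by have := hg hk; linarith)) hJS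
      have h5 := hS.lt (show H * t + g k - 3 * δ < H * t + g k - 2 * δ by linarith) h4
        (hζ0.trans h2)
      have h6 := hθ k (Finset.mem_Icc.2 ⟨h3, hk⟩) (sub_pos.2 h5)
      nlinarith [mul_le_mul_of_nonneg_left hα1 hθ0.le, mul_pos hθ0 hζ0,
        mul_le_mul_of_nonneg_left hβ hθ0.le]
  -- The tails outside `[g (-M), g M]` must cost less than the mixture gains; `θ` is already fixed
  -- and does not depend on `M`.
  obtain ⟨M, hJM, hM⟩ : ∃ M : ℕ, J ≤ M ∧ u < (1 - θ) * (u - √(T (g (-(M : ℤ)))) -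
      √(1 - T (g M))) + θ * (√((1 - ζ) / a) * (a - T (g (-(M : ℤ))))) := by
    have e1 : Tendsto (fun M : ℕ => T (g (-(M : ℤ)))) atTop (𝓝 0) :=
      (hT0.comp (tendsto_grid_atBot hδ)).comp
        (tendsto_neg_atTop_atBot.comp tendsto_natCast_atTop_atTop)
    have e2 : Tendsto (fun M : ℕ => T (g (M : ℤ))) atTop (𝓝 1) :=
      (hT1.comp (tendsto_grid_atTop hδ)).comp tendsto_natCast_atTop_atTop
    have e3 := (Real.continuous_sqrt.tendsto _).comp e1
    have e4 := (Real.continuous_sqrt.tendsto _).comp (e2.const_sub 1)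
    have e5 := (((e3.const_sub u).sub e4).const_mul (1 - θ)).add
      (((e1.const_sub a).const_mul √((1 - ζ) / a)).const_mul θ)
    simp only [sub_self, Real.sqrt_zero, sub_zero] at e5
    have e6 : √((1 - ζ) / a) * a = √(1 - ζ) * √a := by
      rw [Real.sqrt_div (by linarith), div_mul_eq_mul_div, div_eq_iff (Real.sqrt_pos.2 ha0).ne',
        mul_assoc, Real.mul_self_sqrt ha0.le]
    rw [e6] at e5
    have e7 : u < (1 - θ) * u + θ * (√(1 - ζ) * √a) := by
      have := mul_lt_mul_of_pos_left hζu hθ0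
      linarith
    obtain ⟨M, h1, h2⟩ := ((e5.eventually (lt_mem_nhds e7)).and
      (eventually_ge_atTop J.toNat)).exists
    exact ⟨M, by omega, h1⟩
  let c : ℕ → ℝ := fun j => g ((j : ℤ) - M)
  have hc : Monotone c := fun i j hij => hg (by omega)
  have hgood : ∀ j, 0 < v ∨ c j ≠ 0 := fun j => Or.inr (grid_ne_zero hδ _)
  have hc0 : c 0 = g (-(M : ℤ)) := by simp [c]
  have hcm : c (2 * M) = g M := by
    simp only [c]; congr 1; push_cast; ring
  have hTc : Monotone fun j => T (c j) := hT.mono.comp hc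
  obtain ⟨A, hA1, hA2, hA3, hA4⟩ := hC t u c (2 * M) hc hgood h
  rw [hc0, hcm] at hA4
  have hA5 : u - √(T (g (-(M : ℤ)))) - √(1 - T (g M)) ≤ binSum A (fun j => T (c j)) (2 * M) := by
    have h1 : √(A 0 * T (g (-(M : ℤ)))) ≤ √(T (g (-(M : ℤ)))) :=
      Real.sqrt_le_sqrt (mul_le_of_le_one_left (hT.nonneg _) (hA2 0).2)
    have h2 : √((1 - A (2 * M)) * (1 - T (g M))) ≤ √(1 - T (g M)) :=
      Real.sqrt_le_sqrt (mul_le_of_le_one_left (sub_nonneg.2 (hT.le_one _))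
        (by linarith [(hA2 (2 * M)).1]))
    linarith
  let r := (1 - ζ) / a
  have hr0 : 0 < r := div_pos (by linarith) ha0
  have hra : r * a = 1 - ζ := div_mul_cancel₀ _ ha0.ne'
  -- The competitor ignores `S` below `J`: a mass `ζ` at the far left plus `1 - ζ` times the target
  -- conditioned on lying left of `g J`. Its bin sum is nearly `√(1 - ζ) * √a > u`, so mixing it
  -- with `A` gains by concavity.
  let B : ℕ → ℝ := fun j => ζ + r * min a (T (c j))
  have hB1 : Monotone B := fun i j hij => by
    have := hTc hij
    simp only [B]
    gcongr
  have hBζ : ∀ j, ζ ≤ B j := fun j =>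
    le_add_of_nonneg_right (mul_nonneg hr0.le (le_min ha0.le (hT.nonneg _)))
  have hB2 : ∀ j, B j ≤ 1 := fun j => by
    have := mul_le_mul_of_nonneg_left (min_le_left a (T (c j))) hr0.le
    simp only [B]
    linarith
  have hB3 : √r * (a - T (g (-(M : ℤ)))) ≤ binSum B (fun j => T (c j)) (2 * M) := by
    have h1 : √r * (min a (T (c (2 * M))) - min a (T (c 0))) ≤
        binSum B (fun j => T (c j)) (2 * M) := by
      rw [← Finset.sum_range_sub (fun j => min a (T (c j))), Finset.mul_sum]
      refine Finset.sum_le_sum fun j _ => ?_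
      have h2 : T (c j) ≤ T (c (j + 1)) := hTc (Nat.le_succ j)
      have h3 : min a (T (c (j + 1))) - min a (T (c j)) ≤ T (c (j + 1)) - T (c j) := by
        rcases le_total a (T (c (j + 1))) with h4 | h4
        · rw [min_eq_left h4]
          rcases le_total a (T (c j)) with h5 | h5
          · rw [min_eq_left h5]; linarith
          · rw [min_eq_right h5]; linarith
        · rw [min_eq_right h4, min_eq_right (h2.trans h4)]
      have h4 : 0 ≤ min a (T (c (j + 1))) - min a (T (c j)) :=
        sub_nonneg.2 (min_le_min le_rfl h2)
      have h5 : B (j + 1) - B j = r * (min a (T (c (j + 1))) - min a (T (c j))) := by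
        simp only [B]; ring
      rw [h5, mul_assoc, Real.sqrt_mul hr0.le]
      refine mul_le_mul_of_nonneg_left (Real.le_sqrt_of_sq_le ?_) (Real.sqrt_nonneg _)
      rw [sq]
      exact mul_le_mul_of_nonneg_left h3 h4
    refine le_trans (mul_le_mul_of_nonneg_left ?_ (Real.sqrt_nonneg _)) h1
    rw [hcm, hc0, min_eq_left (hT.mono (hg hJM))]
    linarith [min_le_right a (T (g (-(M : ℤ))))]
  have hbin := binSum_concave hA1 hB1 hTc hθ0.le hθ1.le (2 * M)
  have hfinal : u < binSum (fun j => (1 - θ) * A j + θ * B j) (fun j => T (c j)) (2 * M) := by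
    refine hM.trans_le (le_trans (add_le_add ?_ ?_) hbin)
    · exact mul_le_mul_of_nonneg_left hA5 (by linarith)
    · exact mul_le_mul_of_nonneg_left hB3 hθ0.le
  obtain ⟨w, hw1, hw2⟩ := exists_between hfinal
  refine ⟨w, hw1, hD t' c (2 * M) _ hc hgood (fun i j hij => ?_) (fun j => ⟨?_, ?_⟩)
    (fun j _ _ => ⟨H * t + c j - 3 * δ, ?_, ?_⟩) w hw2⟩
  · have h1 := hA1 hij
    have h2 := hB1 hij
    have h3 : 0 ≤ 1 - θ := by linarith
    gcongr
  · exact add_nonneg (mul_nonneg (by linarith) (hA2 j).1) (mul_nonneg hθ0.le (hζ0.le.trans (hBζ j)))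
  · have h1 := mul_le_mul_of_nonneg_left (hA2 j).2 (show 0 ≤ 1 - θ by linarith)
    have h2 := mul_le_mul_of_nonneg_left (hB2 j) hθ0.le
    linarith
  · have h1 : c (j + 1) = c j + δ := by
      simp only [c]
      rw [← hg1]
      congr 1
      push_cast
      ring
    rw [h1, hδt]
    linarith
  · have hAS : S (H * t + c j - 2 * δ) ≤ A j := hA3 j _ (by linarith)
    rcases le_or_gt ((j : ℤ) - M) J with hj | hj
    · exact hdom _ hj (A j) (B j) (hA2 j).1 (hA2 j).2 (hBζ j) hAS
    · have h1 : B j = 1 := by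
        simp only [B]
        rw [min_eq_left (hT.mono (hg hj.le)), hra]
        ring
      have h2 : S (H * t + c j - 3 * δ) ≤ S (H * t + c j - 2 * δ) := hS.mono (by linarith)
      have h3 := mul_le_mul_of_nonneg_left (hA2 j).2 hθ0.le
      rw [h1]
      linarith

/-- For very negative `t` the profile is still below `r⁻¹` beyond the bin `[-r, r]`, so mass `1 -
r⁻¹` can be placed on that single bin, which holds almost all of the target. -/
theorem exists_eventually_lt (hH : 0 < H) (hD : Achievable FD S T H v)
    (hS0 : Tendsto S atBot (𝓝 0)) (hT0 : Tendsto T atBot (𝓝 0)) (hT1 : Tendsto T atTop (𝓝 1))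
    {u : ℝ} (hu1 : u < 1) :
    ∃ t, ∃ w > u, ∀ᶠ n in atTop, w ≤ FD t n := by
  have h1 : Tendsto (fun r : ℝ => √((1 - r⁻¹) * (T r - T (-r)))) atTop (𝓝 1) := by
    have := (Real.continuous_sqrt.tendsto _).comp
      ((tendsto_inv_atTop_zero.const_sub (1 : ℝ)).mul (hT1.sub (hT0.comp tendsto_neg_atTop_atBot)))
    simpa [Function.comp_def] using this
  obtain ⟨r, hr, hr1⟩ := ((h1.eventually (lt_mem_nhds hu1)).and (eventually_gt_atTop 1)).exists
  have hr0 : 0 < r := one_pos.trans hr1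
  have hri : 0 < r⁻¹ := inv_pos.2 hr0
  have hri1 : r⁻¹ < 1 := inv_lt_one_of_one_lt₀ hr1
  have h2 : Tendsto (fun t : ℝ => H * t + r + 1) atBot atBot :=
    tendsto_atBot_add_const_right _ _ (tendsto_atBot_add_const_right _ _
      (tendsto_id.const_mul_atBot hH))
  obtain ⟨t, ht⟩ := ((hS0.comp h2).eventually (gt_mem_nhds hri)).exists
  obtain ⟨w, hw1, hw2⟩ := exists_between hr
  refine ⟨t, w, hw1, hD t (fun j => if j = 0 then -r else r) 1 (fun j => if j = 0 then r⁻¹ else 1)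
    ?_ ?_ ?_ ?_ ?_ w ?_⟩
  · intro i j hij
    dsimp only
    split_ifs <;> first | linarith | omega
  · intro j
    right
    split_ifs <;> linarith
  · intro i j hij
    dsimp only
    split_ifs <;> first | linarith | omega
  · intro j
    split_ifs <;> constructor <;> linarith
  · intro j hj _
    obtain rfl : j = 0 := by omega
    refine ⟨H * t + r + 1, by simp, ?_⟩
    simpa using ht.le
  · simpa [binSum] using hw2

/-- For large `t` the output has almost all its mass before a boundary `c` where the target has
almost none. -/
theorem exists_not_frequently_le (hH : 0 < H) (hC : Converse FM S T H v)
    (hS1 : Tendsto S atTop (𝓝 1)) (hT : IsProfile T) (hT0 : Tendsto T atBot (𝓝 0))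
    {u : ℝ} (hu0 : 0 < u) :
    ∃ t, ¬ ∀ u' < u, ∃ᶠ n in atTop, u' ≤ FM t n := by
  have h1 : Tendsto (fun x => √(T x)) atBot (𝓝 0) := by
    simpa [Function.comp_def] using (Real.continuous_sqrt.tendsto _).comp hT0
  obtain ⟨c, hc, hc0⟩ := ((h1.eventually (gt_mem_nhds (half_pos hu0))).and
    (eventually_lt_atBot 0)).exists
  have h2 : Tendsto (fun t => √(1 - S (H * t + c - 1))) atTop (𝓝 0) := by
    have h3 : Tendsto (fun t : ℝ => H * t + c - 1) atTop atTop :=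
      tendsto_atTop_add_const_right _ _ (tendsto_atTop_add_const_right _ _
        (tendsto_id.const_mul_atTop hH))
    simpa [Function.comp_def] using (Real.continuous_sqrt.tendsto _).comp ((hS1.comp h3).const_sub 1)
  obtain ⟨t, ht⟩ := (h2.eventually (gt_mem_nhds (half_pos hu0))).exists
  refine ⟨t, fun h => ?_⟩
  obtain ⟨A, -, hA2, hA3, hA4⟩ := hC t u (fun _ => c) 0 monotone_const (fun _ => Or.inr hc0.ne) h
  have h4 := hA3 0 (H * t + c - 1) (by linarith)
  have h5 : √(A 0 * T c) ≤ √(T c) :=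
    Real.sqrt_le_sqrt (mul_le_of_le_one_left (hT.nonneg _) (hA2 0).2)
  have h6 : √((1 - A 0) * (1 - T c)) ≤ √(1 - S (H * t + c - 1)) := by
    refine Real.sqrt_le_sqrt (le_trans (mul_le_of_le_one_right ?_ ?_) (by linarith))
    · linarith [(hA2 0).2]
    · linarith [hT.nonneg c]
  simp only [binSum, Finset.range_zero, Finset.sum_empty, add_zero] at hA4
  linarith

/-- Continuity of the accuracy, if increments of `T` change continuously under shifts. -/
theorem exists_forall_eventually_le (hH : 0 < H) (hv : 0 < v) (hC : Converse FM S T H v)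
    (hD : Achievable FD S T H v) (hT : IsProfile T) (hT0 : Tendsto T atBot (𝓝 0))
    (hT1 : Tendsto T atTop (𝓝 1))
    (hshift : ∀ R : ℝ, ∀ ε > 0, ∃ s₀ > 0, ∀ s, 0 ≤ s → s ≤ s₀ → ∀ a b, -R ≤ a → a ≤ b → b ≤ R →
      (1 - ε) * (T b - T a) ≤ T (b - s) - T (a - s)) {ε : ℝ} (hε : 0 < ε) :
    ∃ d > 0, ∀ t t' u, t < t' → t' < t + d → u ≤ 1 → (∀ u' < u, ∃ᶠ n in atTop, u' ≤ FM t n) →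
      ∀ᶠ n in atTop, u - ε ≤ FD t' n := by
  wlog hε1 : ε < 1 generalizing ε
  · obtain ⟨d, hd, h⟩ := this (ε := 1 / 2) (by norm_num) (by norm_num)
    refine ⟨d, hd, fun t t' u h1 h2 h3 h4 => (h t t' u h1 h2 h3 h4).mono fun n hn => ?_⟩
    linarith
  have h1 : Tendsto (fun R => √(T (-R)) + √(1 - T R)) atTop (𝓝 0) := by
    simpa using ((Real.continuous_sqrt.tendsto _).comp (hT0.comp tendsto_neg_atTop_atBot)).add
      ((Real.continuous_sqrt.tendsto _).comp (hT1.const_sub 1))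
  obtain ⟨R, hR, hR0⟩ := ((h1.eventually (gt_mem_nhds (half_pos hε))).and
    (eventually_gt_atTop 0)).exists
  obtain ⟨s₀, hs₀, hs⟩ := hshift R (ε / 4) (by positivity)
  obtain ⟨m, hm⟩ := exists_nat_gt (8 * R / s₀)
  -- The bins of `[-R, R]` are narrow enough that `2 * δ`, added to the change of target below `s₀ /
  -- 2`, stays within `s₀`.
  have hm0 : (0 : ℝ) < m := lt_trans (by positivity) hm
  set δ := 2 * R / m with hδ
  have hδ0 : 0 < δ := by positivity
  have hδs : 4 * δ < s₀ := by
    rw [div_lt_iff₀ hs₀] at hm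
    rw [hδ, ← mul_div_assoc, div_lt_iff₀ hm0]
    linarith
  refine ⟨s₀ / (2 * H), by positivity, fun t t' u htt' htd hu1 h => ?_⟩
  have hκ : H * (t' - t) < s₀ / 2 := by
    have h2 : t' - t < s₀ / (2 * H) := by linarith
    calc H * (t' - t) < H * (s₀ / (2 * H)) := by gcongr
      _ = s₀ / 2 := by field_simp
  have hκ0 : 0 < H * (t' - t) := mul_pos hH (sub_pos.2 htt')
  -- The same `A` is kept for `t'`, with boundaries moved left by `s`. This undoes the change of
  -- target and leaves `2 * δ` for the bin width and strictness, so only the increments of `T`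
  -- change.
  set s := H * (t' - t) + 2 * δ with hsdef
  let c : ℕ → ℝ := fun j => -R + j * δ
  have hc : Monotone c := fun i j hij => by
    have : (i : ℝ) ≤ j := by exact_mod_cast hij
    simp only [c]
    gcongr
  have hc0 : c 0 = -R := by simp [c]
  have hcm : c m = R := by
    simp only [c]
    rw [hδ, mul_div_cancel₀ _ hm0.ne']
    ring
  obtain ⟨A, hA1, hA2, hA3, hA4⟩ := hC t u c m hc (fun _ => Or.inl hv) h
  rw [hc0, hcm] at hA4
  have hA5 : u - ε / 2 < binSum A (fun j => T (c j)) m := by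
    have h1 : √(A 0 * T (-R)) ≤ √(T (-R)) :=
      Real.sqrt_le_sqrt (mul_le_of_le_one_left (hT.nonneg _) (hA2 0).2)
    have h2 : √((1 - A m) * (1 - T R)) ≤ √(1 - T R) :=
      Real.sqrt_le_sqrt (mul_le_of_le_one_left (sub_nonneg.2 (hT.le_one _))
        (by linarith [(hA2 m).1]))
    linarith
  have hA6 : (1 - ε / 4) * binSum A (fun j => T (c j)) m ≤ binSum A (fun j => T (c j - s)) m := by
    rw [binSum, binSum, Finset.mul_sum]
    refine Finset.sum_le_sum fun j hj => ?_
    have hjm := Finset.mem_range.1 hj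
    have h2 : -R ≤ c j := hc0 ▸ hc (Nat.zero_le j)
    have h3 : c (j + 1) ≤ R := hcm ▸ hc hjm
    have h4 := hs s (by linarith) (by linarith) (c j) (c (j + 1)) h2 (hc (Nat.le_succ j)) h3
    have hA' := sub_nonneg.2 (hA1 (Nat.le_succ j))
    have hT' := sub_nonneg.2 (hT.mono (hc (Nat.le_succ j)))
    have h5 : 0 ≤ 1 - ε / 4 := by linarith
    rw [← Real.sqrt_sq h5, ← Real.sqrt_mul (sq_nonneg _)]
    refine Real.sqrt_le_sqrt ?_
    have h6 : (1 - ε / 4) ^ 2 ≤ 1 - ε / 4 := by nlinarith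
    calc (1 - ε / 4) ^ 2 * ((A (j + 1) - A j) * (T (c (j + 1)) - T (c j)))
        ≤ (1 - ε / 4) * ((A (j + 1) - A j) * (T (c (j + 1)) - T (c j))) :=
          mul_le_mul_of_nonneg_right h6 (mul_nonneg hA' hT')
      _ = (A (j + 1) - A j) * ((1 - ε / 4) * (T (c (j + 1)) - T (c j))) := by ring
      _ ≤ _ := mul_le_mul_of_nonneg_left h4 hA'
  refine hD t' (fun j => c j - s) m A (fun i j hij => sub_le_sub_right (hc hij) s)
    (fun _ => Or.inl hv) hA1 hA2 (fun j _ _ => ⟨H * t + c j - δ / 2, ?_, ?_⟩) (u - ε) ?_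
  · have h2 : c (j + 1) = c j + δ := by simp only [c]; push_cast; ring
    rw [h2, hsdef]
    linarith
  · exact hA3 j _ (by linarith)
  · refine lt_of_lt_of_le ?_ hA6
    have h2 : (1 - ε / 4) * (u - ε / 2) < (1 - ε / 4) * binSum A (fun j => T (c j)) m :=
      mul_lt_mul_of_pos_left hA5 (by linarith)
    nlinarith

end Gap

/-! ### Increments of the normal distribution function under shifts. -/

section Shift

open MeasureTheory ProbabilityTheory

theorem normalCdf_sub_eq_integral {v : ℝ} (hv : 0 < v) {a b : ℝ} (h : a ≤ b) :
    normalCdf v b - normalCdf v a = ∫ x in a..b, gaussianPDFReal 0 v.toNNReal x := by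
  have hv' : v.toNNReal ≠ 0 := by simpa using hv
  have h1 := ofReal_normalCdf_sub v a b
  rw [gaussianReal_apply_eq_integral _ hv', ENNReal.ofReal_eq_ofReal_iff] at h1
  · rw [h1, intervalIntegral.integral_of_le h]
  · exact sub_nonneg.2 (normalCdf_mono v h)
  · exact integral_nonneg fun x => gaussianPDFReal_nonneg _ _ _

/-- On a bounded range the ratio of shifted to unshifted density is uniformly close to at least `1`.
The bound is multiplicative, so it passes to bin sums however many bins there are. The choice of
`s₀` comes from `(x - s) ^ 2 - x ^ 2 ≤ s * (1 + 2 * |R|)` for `x ≥ -R` and `s ≤ 1`. -/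
theorem normalCdf_shift {v : ℝ} (hv : 0 < v) (R : ℝ) {ε : ℝ} (hε : 0 < ε) :
    ∃ s₀ > 0, ∀ s, 0 ≤ s → s ≤ s₀ → ∀ a b, -R ≤ a → a ≤ b → b ≤ R →
      (1 - ε) * (normalCdf v b - normalCdf v a) ≤ normalCdf v (b - s) - normalCdf v (a - s) := by
  refine ⟨min 1 (2 * v * ε / (1 + 2 * |R|)), lt_min one_pos (by positivity),
    fun s hs0 hs a b ha hab hb => ?_⟩
  have hs1 : s ≤ 1 := hs.trans (min_le_left _ _)
  have hs2 : s * (1 + 2 * |R|) ≤ 2 * v * ε := by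
    have := hs.trans (min_le_right _ _)
    rwa [le_div_iff₀ (by positivity)] at this
  rw [normalCdf_sub_eq_integral hv hab, normalCdf_sub_eq_integral hv (by linarith),
    ← intervalIntegral.integral_comp_sub_right, ← intervalIntegral.integral_const_mul]
  have hint : ∀ c : ℝ, Continuous fun x => gaussianPDFReal 0 v.toNNReal (x - c) := fun c => by
    unfold gaussianPDFReal
    fun_prop
  refine intervalIntegral.integral_mono_on hab ?_ ((hint s).intervalIntegrable _ _) fun x hx => ?_
  · exact (Continuous.const_mul (by simpa using hint 0) _).intervalIntegrable _ _
  · simp only [gaussianPDFReal, Real.coe_toNNReal _ hv.le, sub_zero]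
    rw [mul_left_comm]
    refine mul_le_mul_of_nonneg_left ?_ (by positivity)
    have h1 : Real.exp (-(x - s) ^ 2 / (2 * v)) =
        Real.exp (-((x - s) ^ 2 - x ^ 2) / (2 * v)) * Real.exp (-x ^ 2 / (2 * v)) := by
      rw [← Real.exp_add]
      congr 1
      ring
    rw [h1]
    refine mul_le_mul_of_nonneg_right ?_ (Real.exp_nonneg _)
    refine le_trans ?_ (Real.add_one_le_exp _)
    have h2 : ((x - s) ^ 2 - x ^ 2) ≤ ε * (2 * v) := by
      have h3 : -|R| ≤ x := by linarith [hx.1, le_abs_self R]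
      nlinarith
    have h4 : ((x - s) ^ 2 - x ^ 2) / (2 * v) ≤ ε := (div_le_iff₀ (by positivity)).2 h2
    rw [neg_div]
    linarith

theorem normalCdf_div_shift {v k : ℝ} (hv : 0 < v) (hk : 0 < k) (R : ℝ) {ε : ℝ} (hε : 0 < ε) :
    ∃ s₀ > 0, ∀ s, 0 ≤ s → s ≤ s₀ → ∀ a b, -R ≤ a → a ≤ b → b ≤ R →
      (1 - ε) * (normalCdf v (b / k) - normalCdf v (a / k)) ≤
        normalCdf v ((b - s) / k) - normalCdf v ((a - s) / k) := by
  obtain ⟨s₀, hs₀, h⟩ := normalCdf_shift hv (R / k) hε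
  refine ⟨s₀ * k, by positivity, fun s hs hs' a b ha hab hb => ?_⟩
  have := h (s / k) (by positivity) ((div_le_iff₀ hk).2 hs') (a / k) (b / k)
    (by rw [← neg_div]; gcongr) (by gcongr) (by gcongr)
  rwa [← sub_div, ← sub_div] at this

end Shift

/-! ### Zero entropy, and existence of the maxima. -/

section Entropy

variable {X Y : Type*} [Fintype X] [Fintype Y]

theorem shannonEntropy_eq_zero_of_eq_one {P : X → ℝ} (hP : P ∈ stdSimplex ℝ X) {x : X}
    (hx : P x = 1) : shannonEntropy P = 0 := by
  classical
  have h : ∀ y, y ≠ x → P y = 0 := by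
    intro y hy
    have h1 : P x + P y ≤ 1 := by
      rw [← hP.2, ← Finset.sum_pair hy.symm]
      exact Finset.sum_le_sum_of_subset_of_nonneg (Finset.subset_univ _) fun z _ _ => hP.1 z
    linarith [hP.1 y]
  rw [shannonEntropy, neg_eq_zero]
  refine Finset.sum_eq_zero fun y _ => ?_
  by_cases hy : y = x
  · rw [hy, hx]; simp
  · rw [h y hy]; simp

theorem le_one_of_mem_stdSimplex {P : X → ℝ} (hP : P ∈ stdSimplex ℝ X) (x : X) : P x ≤ 1 := by
  rw [← hP.2]
  exact Finset.single_le_sum (fun y _ => hP.1 y) (Finset.mem_univ x)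

theorem exists_eq_one_of_shannonEntropy_eq_zero {P : X → ℝ} (hP : P ∈ stdSimplex ℝ X)
    (h : shannonEntropy P = 0) : ∃ x, P x = 1 := by
  have h1 : ∀ x ∈ Finset.univ, 0 ≤ -(P x * Real.logb 2 (P x)) := fun x _ => by
    have := Real.logb_nonpos one_lt_two (hP.1 x) (le_one_of_mem_stdSimplex hP x)
    nlinarith [hP.1 x]
  rw [shannonEntropy, ← Finset.sum_neg_distrib, Finset.sum_eq_zero_iff_of_nonneg h1] at h
  obtain ⟨x, hx⟩ : ∃ x, 0 < P x := by
    by_contra hcon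
    push Not at hcon
    have := Finset.sum_nonpos fun x (_ : x ∈ Finset.univ) => hcon x
    linarith [hP.2]
  refine ⟨x, le_antisymm (le_one_of_mem_stdSimplex hP x) (not_lt.1 fun hlt => ?_)⟩
  have h2 := Real.logb_neg one_lt_two hx hlt
  have h3 := h x (Finset.mem_univ x)
  nlinarith

theorem exists_forall_le_lt_one {Q : Y → ℝ} (hQ : Q ∈ stdSimplex ℝ Y) (hH : 0 < shannonEntropy Q) :
    ∃ q, 0 ≤ q ∧ q < 1 ∧ ∀ y, Q y ≤ q := by
  have hne : (Finset.univ : Finset Y).Nonempty := by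
    by_contra h
    rw [Finset.not_nonempty_iff_eq_empty] at h
    have := hQ.2
    rw [h] at this
    simp at this
  obtain ⟨y, -, hy⟩ := Finset.exists_max_image Finset.univ Q hne
  refine ⟨Q y, hQ.1 y, (le_one_of_mem_stdSimplex hQ y).lt_of_ne fun h => ?_,
    fun z => hy z (Finset.mem_univ z)⟩
  exact hH.ne' (shannonEntropy_eq_zero_of_eq_one hQ h)

theorem bddAbove_copiesM (P : X → ℝ) {Q : Y → ℝ} (hQ : Q ∈ stdSimplex ℝ Y)
    (hH : 0 < shannonEntropy Q) {ν : ℝ} (hν : 0 < ν) (N : ℕ) : BddAbove (copiesM P Q ν N) := by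
  obtain ⟨q, hq0, hq1, hq⟩ := exists_forall_le_lt_one hQ hH
  have h1 : Tendsto (fun L : ℕ => (2 : ℝ) ^ N * q ^ L) atTop (𝓝 0) := by
    simpa using (tendsto_pow_atTop_nhds_zero_of_lt_one hq0 hq1).const_mul ((2 : ℝ) ^ N)
  obtain ⟨L₀, hL₀⟩ := eventually_atTop.1 (h1.eventually (gt_mem_nhds (pow_pos hν 2)))
  refine ⟨L₀, fun L hL => ?_⟩
  by_contra hlt
  obtain ⟨r, hr, hνr⟩ := hL
  have h2 := hνr.trans (le_sqrt_of_mem_fidelitiesM hQ hq hr)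
  rw [Real.le_sqrt hν.le (by positivity)] at h2
  linarith [hL₀ L (not_le.1 hlt).le]

theorem isGreatest_sSup {s : Set ℕ} (hs : s.Nonempty) (hb : BddAbove s) : IsGreatest s (sSup s) :=
  ⟨Nat.sSup_mem hs hb, fun _ h => le_csSup hb h⟩

end Entropy

/-! ### The threshold and the expansions. -/

section Main

theorem lt_liminf {f : ℕ → ℝ} (hf : ∀ n, f n ≤ 1) {u w : ℝ} (huw : u < w)
    (h : ∀ᶠ n in atTop, w ≤ f n) : u < liminf f atTop :=
  huw.trans_le (le_liminf_of_le (isCoboundedUnder_ge_of_le _ hf) h)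

theorem liminf_lt {f : ℕ → ℝ} (hf : ∀ n, 0 ≤ f n) {u w : ℝ} (huw : w < u)
    (h : ∀ᶠ n in atTop, f n < w) : liminf f atTop < u := by
  refine lt_of_le_of_lt ?_ huw
  rw [liminf_eq]
  refine csSup_le ⟨0, Eventually.of_forall hf⟩ fun a ha => ?_
  obtain ⟨n, hn1, hn2⟩ := (h.and ha).exists
  exact hn2.trans hn1.le

variable {X Y : Type*} [Fintype X] [Fintype Y]

/-- The expansions of the numbers of copies follow from the point at which the accuracies pass
through `ν`. -/
theorem exists_expansion {P : X → ℝ} (hP : P ∈ stdSimplex ℝ X) {Q : Y → ℝ}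
    (hQ : Q ∈ stdSimplex ℝ Y) (hHQ : 0 < shannonEntropy Q) {s₁ s₂ t₁ ν τ : ℝ} (hν₀ : 0 < ν)
    (hν₁ : ν < 1)
    (hlt : ∀ t < τ, ∃ w > ν, ∀ᶠ n : ℕ in atTop,
      w ≤ maxFidelityD (iid P n) (iid Q (size t₁ t n)) (size s₁ s₂ n))
    (hgt : ∀ t, τ < t → ∃ w < ν, ∀ᶠ n : ℕ in atTop,
      maxFidelityM (iid P n) (iid Q (size t₁ t n)) (size s₁ s₂ n) < w) :
    IsInverseAt (accuracyD P Q s₁ t₁ s₂) ν τ ∧ IsInverseAt (accuracyM P Q s₁ t₁ s₂) ν τ ∧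
    ∃ LD LM : ℕ → ℕ,
      (∀ n, IsGreatest (copiesD (iid P n) Q ν (size s₁ s₂ n)) (LD n)) ∧
      (∀ n, IsGreatest (copiesM (iid P n) Q ν (size s₁ s₂ n)) (LM n)) ∧
      (fun n : ℕ => (LD n : ℝ) - (LM n : ℝ)) =o[atTop] (fun n : ℕ => √(n : ℝ)) ∧
      (fun n : ℕ => (LD n : ℝ) - (t₁ * n + τ * √(n : ℝ))) =o[atTop] (fun n : ℕ => √(n : ℝ)) ∧
      (fun n : ℕ => (LM n : ℝ) - (t₁ * n + τ * √(n : ℝ))) =o[atTop] (fun n : ℕ => √(n : ℝ)) := by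
  have hDM : ∀ t (n : ℕ), maxFidelityD (iid P n) (iid Q (size t₁ t n)) (size s₁ s₂ n) ≤
      maxFidelityM (iid P n) (iid Q (size t₁ t n)) (size s₁ s₂ n) := fun t n =>
    maxFidelityD_le_maxFidelityM (iid_mem_stdSimplex hP n) (iid_mem_stdSimplex hQ _) _
  have hM1 : ∀ t (n : ℕ), maxFidelityM (iid P n) (iid Q (size t₁ t n)) (size s₁ s₂ n) ≤ 1 :=
    fun t n => maxFidelityM_le_one (iid_mem_stdSimplex hP n) (iid_mem_stdSimplex hQ _) _
  have hD0 : ∀ t (n : ℕ), 0 ≤ maxFidelityD (iid P n) (iid Q (size t₁ t n)) (size s₁ s₂ n) :=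
    fun t n => maxFidelityD_nonneg _ _ _
  refine ⟨⟨fun t ht => ?_, fun t ht => ?_⟩, ⟨fun t ht => ?_, fun t ht => ?_⟩, ?_⟩
  · obtain ⟨w, hw, h⟩ := hlt t ht
    exact lt_liminf (fun n => (hDM t n).trans (hM1 t n)) hw h
  · obtain ⟨w, hw, h⟩ := hgt t ht
    exact liminf_lt (hD0 t) hw (h.mono fun n hn => (hDM t n).trans_lt hn)
  · obtain ⟨w, hw, h⟩ := hlt t ht
    exact lt_liminf (hM1 t) hw (h.mono fun n hn => hn.trans (hDM t n))
  · obtain ⟨w, hw, h⟩ := hgt t ht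
    exact liminf_lt (fun n => (hD0 t n).trans (hDM t n)) hw h
  have hbM : ∀ n : ℕ, BddAbove (copiesM (iid P n) Q ν (size s₁ s₂ n)) := fun n =>
    bddAbove_copiesM _ hQ hHQ hν₀ _
  have hsub : ∀ n : ℕ, copiesD (iid P n) Q ν (size s₁ s₂ n) ⊆ copiesM (iid P n) Q ν (size s₁ s₂ n) :=
    fun n => copiesD_subset_copiesM (iid_mem_stdSimplex hP n) Q ν _
  have hneD : ∀ n : ℕ, (copiesD (iid P n) Q ν (size s₁ s₂ n)).Nonempty := fun n =>
    ⟨0, zero_mem_copiesD (iid_mem_stdSimplex hP n) hQ hν₁.le _⟩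
  have hLD := fun n => isGreatest_sSup (hneD n) ((hbM n).mono (hsub n))
  have hLM := fun n => isGreatest_sSup ((hneD n).mono (hsub n)) (hbM n)
  set LD : ℕ → ℕ := fun n => sSup (copiesD (iid P n) Q ν (size s₁ s₂ n))
  set LM : ℕ → ℕ := fun n => sSup (copiesM (iid P n) Q ν (size s₁ s₂ n))
  have hle : ∀ n, LD n ≤ LM n := fun n => (hLM n).2 (hsub n (hLD n).1)
  -- The strict margin `w > ν` yields an actual conversion although the supremum need not be
  -- attained; `ε / 2 * √n ≥ 1` absorbs the rounding.
  have hlower : ∀ ε > 0, ∀ᶠ n : ℕ in atTop, t₁ * n + τ * √(n : ℝ) - ε * √(n : ℝ) ≤ LD n := by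
    intro ε hε
    obtain ⟨w, hw, h⟩ := hlt (τ - ε / 2) (by linarith)
    have h1 : Tendsto (fun n : ℕ => ε / 2 * √(n : ℝ)) atTop atTop :=
      tendsto_sqrt_natCast_atTop.const_mul_atTop (half_pos hε)
    filter_upwards [h, h1.eventually (eventually_ge_atTop 1)] with n hn hn1
    obtain ⟨r, hr, hlt⟩ := exists_lt_of_lt_csSup
      (fidelitiesD_nonempty (iid P n) (iid_mem_stdSimplex hQ _) _) (hw.trans_le hn)
    have h2 : size t₁ (τ - ε / 2) n ≤ LD n := (hLD n).2 ⟨r, hr, hlt.le⟩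
    have h3 := Nat.sub_one_lt_floor (t₁ * n + (τ - ε / 2) * √(n : ℝ))
    have h4 : (size t₁ (τ - ε / 2) n : ℝ) ≤ LD n := by exact_mod_cast h2
    rw [size] at h4
    linarith
  -- Failure at one number of copies excludes all larger ones by `copiesM_of_le`. Deterministic
  -- conversion is then bounded through `LD n ≤ LM n`.
  have hupper : ∀ ε > 0, ∀ᶠ n : ℕ in atTop, (LM n : ℝ) ≤ t₁ * n + τ * √(n : ℝ) + ε * √(n : ℝ) := by
    intro ε hε
    obtain ⟨w, hw, h⟩ := hgt (τ + ε) (by linarith)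
    filter_upwards [h] with n hn
    have h2 : LM n < size t₁ (τ + ε) n := by
      by_contra hcon
      obtain ⟨r, hr, hνr⟩ := copiesM_of_le hQ (not_lt.1 hcon) (hLM n).1
      have : r ≤ maxFidelityM (iid P n) (iid Q (size t₁ (τ + ε) n)) (size s₁ s₂ n) :=
        le_csSup (bddAbove_fidelitiesM _ (iid_mem_stdSimplex hQ _) _) hr
      linarith
    have h3 : (0 : ℝ) < t₁ * n + (τ + ε) * √(n : ℝ) :=
      Nat.pos_of_floor_pos (lt_of_le_of_lt (Nat.zero_le _) h2)
    have h4 := Nat.floor_le h3.le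
    have h5 : (LM n : ℝ) < size t₁ (τ + ε) n := by exact_mod_cast h2
    rw [size] at h5
    linarith
  have hoD : (fun n : ℕ => (LD n : ℝ) - (t₁ * n + τ * √(n : ℝ))) =o[atTop]
      (fun n : ℕ => √(n : ℝ)) := by
    refine isLittleO_iff.2 fun ε hε => ?_
    filter_upwards [hlower ε hε, hupper ε hε] with n h1 h2
    have h3 : (LD n : ℝ) ≤ LM n := by exact_mod_cast hle n
    rw [Real.norm_eq_abs, Real.norm_eq_abs, abs_of_nonneg (Real.sqrt_nonneg _), abs_le]
    constructor <;> linarith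
  have hoM : (fun n : ℕ => (LM n : ℝ) - (t₁ * n + τ * √(n : ℝ))) =o[atTop]
      (fun n : ℕ => √(n : ℝ)) := by
    refine isLittleO_iff.2 fun ε hε => ?_
    filter_upwards [hlower ε hε, hupper ε hε] with n h1 h2
    have h3 : (LD n : ℝ) ≤ LM n := by exact_mod_cast hle n
    rw [Real.norm_eq_abs, Real.norm_eq_abs, abs_of_nonneg (Real.sqrt_nonneg _), abs_le]
    constructor <;> linarith
  exact ⟨LD, LM, hLD, hLM, (hoD.sub hoM).congr_left fun n => by ring, hoD, hoM⟩

/-- The case of a deterministic source. -/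
theorem maxFidelity_of_shannonEntropy_eq_zero {P : X → ℝ} (hP : P ∈ stdSimplex ℝ X) {Q : Y → ℝ}
    (hQ : Q ∈ stdSimplex ℝ Y) (hHQ : 0 < shannonEntropy Q) (h0 : shannonEntropy P = 0)
    {s₁ s₂ ν : ℝ} (hν₀ : 0 < ν) (hν₁ : ν < 1) :
    (∀ t < 0, ∃ w > ν, ∀ᶠ n : ℕ in atTop,
      w ≤ maxFidelityD (iid P n) (iid Q (size 0 t n)) (size s₁ s₂ n)) ∧
    (∀ t, 0 < t → ∃ w < ν, ∀ᶠ n : ℕ in atTop,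
      maxFidelityM (iid P n) (iid Q (size 0 t n)) (size s₁ s₂ n) < w) := by
  constructor
  · intro t ht
    refine ⟨1, hν₁, Eventually.of_forall fun n => ?_⟩
    -- A negative number of copies is rounded to `0`, and zero copies are produced perfectly.
    have h1 : size 0 t n = 0 := by
      rw [size, Nat.floor_eq_zero]
      have := mul_nonpos_of_nonpos_of_nonneg ht.le (Real.sqrt_nonneg (n : ℝ))
      linarith
    rw [h1]
    obtain ⟨r, hr, hr1⟩ := zero_mem_copiesD (iid_mem_stdSimplex hP n) hQ (ν := 1) le_rfl
      (size s₁ s₂ n)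
    exact hr1.trans (le_maxFidelityD (iid_mem_stdSimplex hP n) (iid_mem_stdSimplex hQ 0) hr)
  · intro t ht
    obtain ⟨x, hx⟩ := exists_eq_one_of_shannonEntropy_eq_zero hP h0
    obtain ⟨q, hq0, hq1, hq⟩ := exists_forall_le_lt_one hQ hHQ
    refine ⟨ν / 2, by linarith, ?_⟩
    have h1 : Tendsto (fun L : ℕ => √(q ^ L)) atTop (𝓝 0) := by
      simpa [Function.comp_def] using (Real.continuous_sqrt.tendsto _).comp
        (tendsto_pow_atTop_nhds_zero_of_lt_one hq0 hq1)
    have h2 : Tendsto (size 0 t) atTop atTop := by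
      refine tendsto_nat_floor_atTop.comp ?_
      simpa using tendsto_sqrt_natCast_atTop.const_mul_atTop ht
    filter_upwards [(h1.comp h2).eventually (gt_mem_nhds (half_pos hν₀))] with n hn
    refine lt_of_le_of_lt (csSup_le ?_ ?_) hn
    · exact (fidelitiesD_nonempty _ (iid_mem_stdSimplex hQ _) _).mono
        (fidelitiesD_subset_fidelitiesM (iid_mem_stdSimplex hP n) _ _)
    · rintro r ⟨P', hP', P'', hP'', h3, h4, rfl⟩
      -- Whatever majorizes a point mass has all its mass on a single point.
      have h5 : (1 : ℝ) ≤ topSum P'' 1 := by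
        refine le_trans ?_ ((h3 1).trans (h4 1))
        refine le_trans (le_of_eq ?_) (sum_le_topSum (iid_mem_stdSimplex hP n).1
          (s := {fun _ => x}) (by simp))
        simp [iid, hx]
      simpa using fidelity_le_of_topSum_eq_one hP'' (iid_mem_stdSimplex hQ _)
        (iid_le_pow hQ hq _) h5

/-- The case of a random source. -/
theorem exists_threshold {P : X → ℝ} (hP : P ∈ stdSimplex ℝ X) {Q : Y → ℝ}
    (hQ : Q ∈ stdSimplex ℝ Y) (hHQ : 0 < shannonEntropy Q) (hHP : 0 < shannonEntropy P)
    {s₁ s₂ t₁ ν : ℝ} (hs₁ : 0 < s₁) (ht₁ : t₁ = min (shannonEntropy P) s₁ / shannonEntropy Q)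
    (hν₀ : 0 < ν) (hν₁ : ν < 1) :
    ∃ τ : ℝ, (∀ t < τ, ∃ w > ν, ∀ᶠ n : ℕ in atTop,
        w ≤ maxFidelityD (iid P n) (iid Q (size t₁ t n)) (size s₁ s₂ n)) ∧
      (∀ t, τ < t → ∃ w < ν, ∀ᶠ n : ℕ in atTop,
        maxFidelityM (iid P n) (iid Q (size t₁ t n)) (size s₁ s₂ n) < w) ∧
      (¬ UniformOnSupport Q →
        accuracyD P Q s₁ t₁ s₂ τ = ν ∧ accuracyM P Q s₁ t₁ s₂ τ = ν) := by
  have ht₁0 : 0 < t₁ := ht₁ ▸ div_pos (lt_min hHP hs₁) hHQ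
  have hmul : t₁ * shannonEntropy Q = min (shannonEntropy P) s₁ := by
    rw [ht₁, div_mul_cancel₀ _ hHQ.ne']
  have hk : 0 < √t₁ := Real.sqrt_pos.2 ht₁0
  have hC := converse_maxFidelityM hP hQ hs₁ s₂ ht₁0 hmul
  have hD := achievable_maxFidelityD hP hQ hs₁ s₂ ht₁0 hmul
  have hS := isProfile_limitProfile hP s₁ s₂
  have hS0 := tendsto_limitProfile_atBot P s₁ s₂
  have hS1 := tendsto_limitProfile_atTop hP s₁ s₂
  set FD : ℝ → ℕ → ℝ := fun t n =>
    maxFidelityD (iid P n) (iid Q (size t₁ t n)) (size s₁ s₂ n) with hFD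
  set FM : ℝ → ℕ → ℝ := fun t n =>
    maxFidelityM (iid P n) (iid Q (size t₁ t n)) (size s₁ s₂ n) with hFM
  set T : ℝ → ℝ := fun c => normalCdf (varentropy Q) (c / √t₁) with hTdef
  have hT : IsProfile T :=
    ⟨fun a b h => normalCdf_mono _ (by gcongr), fun _ => normalCdf_nonneg _ _,
      fun _ => normalCdf_le_one _ _,
      fun a b h h1 h2 => normalCdf_lt (varentropy_nonneg hQ) (by gcongr) h1 h2⟩
  have hT0 : Tendsto T atBot (𝓝 0) :=
    (tendsto_normalCdf_atBot _).comp (tendsto_id.atBot_div_const hk)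
  have hT1 : Tendsto T atTop (𝓝 1) :=
    (tendsto_normalCdf_atTop _).comp (tendsto_id.atTop_div_const hk)
  have hDM : ∀ t n, FD t n ≤ FM t n := fun t n =>
    maxFidelityD_le_maxFidelityM (iid_mem_stdSimplex hP n) (iid_mem_stdSimplex hQ _) _
  have hM1 : ∀ t n, FM t n ≤ 1 := fun t n =>
    maxFidelityM_le_one (iid_mem_stdSimplex hP n) (iid_mem_stdSimplex hQ _) _
  have hD0 : ∀ t n, 0 ≤ FD t n := fun t n => maxFidelityD_nonneg _ _ _
  let G : Set ℝ := {t | ∃ w > ν, ∀ᶠ n in atTop, w ≤ FD t n}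
  have hfreq : ∀ t ∈ G, ∀ u' < ν, ∃ᶠ n in atTop, u' ≤ FM t n := by
    rintro t ⟨w, hw, h⟩ u' hu'
    exact (h.mono fun n hn => (hu'.trans hw).le.trans (hn.trans (hDM t n))).frequently
  have hgap : ∀ t t', t' < t → (∀ u' < ν, ∃ᶠ n in atTop, u' ≤ FM t n) → t' ∈ G :=
    fun t t' h1 h2 => exists_eventually_le_of_frequently_le hHQ hC hD hS hS0 hT hT0 hT1 h1 hν₀ hν₁ h2
  have hGne : G.Nonempty := exists_eventually_lt hHQ hD hS0 hT0 hT1 hν₁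
  obtain ⟨b, hb⟩ := exists_not_frequently_le hHQ hC hS1 hT hT0 hν₀
  have hGb : BddAbove G := by
    refine ⟨b, fun t ht => not_lt.1 fun hbt => hb (hfreq b (hgap t b hbt (hfreq t ht)))⟩
  have hbelow : ∀ t < sSup G, t ∈ G := by
    intro t ht
    obtain ⟨t', ht', h⟩ := exists_lt_of_lt_csSup hGne ht
    exact hgap t' t h (hfreq t' ht')
  refine ⟨sSup G, hbelow, fun t ht => ?_, fun hunif => ?_⟩
  · have h1 : ¬ ∀ u' < ν, ∃ᶠ n in atTop, u' ≤ FM t n := by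
      intro h
      obtain ⟨t', h1, h2⟩ := exists_between ht
      exact (le_csSup hGb (hgap t t' h2 h)).not_gt h1
    push Not at h1
    obtain ⟨w, hw, h2⟩ := h1
    exact ⟨w, hw, by simpa using h2⟩
  · have hv := varentropy_pos hQ hunif
    have hcont := fun {ε : ℝ} (hε : 0 < ε) => exists_forall_eventually_le hHQ hv hC hD hT hT0 hT1
      (fun R ε hε => normalCdf_div_shift hv hk R hε) hε
    -- Carry the accuracy from slightly below the threshold up to it, with arbitrarily small loss.
    have hge : ν ≤ liminf (FD (sSup G)) atTop := by
      refine le_of_forall_pos_sub_le fun ε hε => ?_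
      obtain ⟨d, hd, h⟩ := hcont hε
      have h1 := h (sSup G - d / 2) (sSup G) ν (by linarith) (by linarith) hν₁.le
        (hfreq _ (hbelow _ (by linarith)))
      exact le_liminf_of_le (isCoboundedUnder_ge_of_le _ fun n => (hDM _ n).trans (hM1 _ n)) h1
    have hle : liminf (FM (sSup G)) atTop ≤ ν := by
      by_contra hcon
      push Not at hcon
      -- An excess over `ν` at the threshold would, after losing half of it, persist slightly
      -- beyond, putting a larger point in `G`.
      set u := liminf (FM (sSup G)) atTop with hu
      have hbdd : IsBoundedUnder (· ≥ ·) atTop (FM (sSup G)) :=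
        isBoundedUnder_of ⟨0, fun n => (hD0 _ n).trans (hDM _ n)⟩
      have hu1 : u ≤ 1 := by
        rw [hu, liminf_eq]
        refine csSup_le ⟨0, Eventually.of_forall fun n => (hD0 _ n).trans (hDM _ n)⟩ fun a ha => ?_
        obtain ⟨n, hn⟩ := ha.exists
        exact hn.trans (hM1 _ n)
      obtain ⟨d, hd, h⟩ := hcont (half_pos (sub_pos.2 hcon))
      have h1 := h (sSup G) (sSup G + d / 2) u (by linarith) (by linarith) hu1 fun u' hu' =>
        ((eventually_lt_of_lt_liminf hu' hbdd).mono fun n hn => hn.le).frequently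
      have h2 : sSup G + d / 2 ∈ G := ⟨u - (u - ν) / 2, by linarith, h1⟩
      linarith [le_csSup hGb h2]
    have hDMl : liminf (FD (sSup G)) atTop ≤ liminf (FM (sSup G)) atTop :=
      liminf_le_liminf (Eventually.of_forall (hDM _)) (isBoundedUnder_of ⟨0, hD0 _⟩)
        (isCoboundedUnder_ge_of_le _ (hM1 _))
    exact ⟨le_antisymm (hDMl.trans hle) hge, le_antisymm hle (hge.trans hDMl)⟩

end Main

end RNC

theorem theorem2 {X Y : Type*} [Fintype X] [Fintype Y] (P : X → ℝ) (Q : Y → ℝ)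
    (hP : P ∈ stdSimplex ℝ X) (hQ : Q ∈ stdSimplex ℝ Y) (hHQ : 0 < RNC.shannonEntropy Q)
    (s₁ s₂ ν : ℝ) (hs₁ : 0 < s₁) (hν₀ : 0 < ν) (hν₁ : ν < 1) :
    ∃ (LD LM : ℕ → ℕ) (t₁ τ : ℝ),
      -- the maximal numbers of copies
      (∀ n, IsGreatest (RNC.copiesD (RNC.iid P n) Q ν (RNC.size s₁ s₂ n)) (LD n)) ∧
      (∀ n, IsGreatest (RNC.copiesM (RNC.iid P n) Q ν (RNC.size s₁ s₂ n)) (LM n)) ∧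
      -- the first-order rate
      t₁ = min (RNC.shannonEntropy P) s₁ / RNC.shannonEntropy Q ∧
      -- the second-order rate is the inverse at `ν` of the optimal accuracy
      RNC.IsInverseAt (RNC.accuracyD P Q s₁ t₁ s₂) ν τ ∧
      RNC.IsInverseAt (RNC.accuracyM P Q s₁ t₁ s₂) ν τ ∧
      (0 < RNC.shannonEntropy P → ¬ RNC.UniformOnSupport Q →
        RNC.accuracyD P Q s₁ t₁ s₂ τ = ν ∧ RNC.accuracyM P Q s₁ t₁ s₂ τ = ν) ∧
      -- the expansions
      (fun n : ℕ => (LD n : ℝ) - (LM n : ℝ)) =o[atTop] (fun n : ℕ => √(n : ℝ)) ∧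
      (fun n : ℕ => (LD n : ℝ) - (t₁ * n + τ * √(n : ℝ))) =o[atTop] (fun n : ℕ => √(n : ℝ)) ∧
      (fun n : ℕ => (LM n : ℝ) - (t₁ * n + τ * √(n : ℝ))) =o[atTop] (fun n : ℕ => √(n : ℝ)) := by
  -- Without source entropy `t₁ = 0`, and the normalization by `√t₁` breaks down.
  rcases (RNC.shannonEntropy_nonneg hP).eq_or_lt with h0 | h0
  · obtain ⟨hlt, hgt⟩ := RNC.maxFidelity_of_shannonEntropy_eq_zero hP hQ hHQ h0.symm
      (s₁ := s₁) (s₂ := s₂) hν₀ hν₁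
    obtain ⟨h1, h2, LD, LM, h3, h4, h5⟩ := RNC.exists_expansion hP hQ hHQ hν₀ hν₁ hlt hgt
    refine ⟨LD, LM, 0, 0, h3, h4, ?_, h1, h2, fun h => absurd h0 h.ne, h5⟩
    rw [← h0, min_eq_left hs₁.le, zero_div]
  · obtain ⟨τ, hlt, hgt, heq⟩ := RNC.exists_threshold hP hQ hHQ h0 (s₂ := s₂) hs₁ rfl hν₀ hν₁
    obtain ⟨h1, h2, LD, LM, h3, h4, h5⟩ := RNC.exists_expansion hP hQ hHQ hν₀ hν₁ hlt hgt
    exact ⟨LD, LM, _, τ, h3, h4, rfl, h1, h2, fun _ => heq, h5⟩
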